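/- Let $\ell:(0,\infty)\to\mathbb{R}$ be slowly varying at $+\infty$, i.e. measurable, eventually positive, and such that $\ell(\lambda x)/\ell(x)\to 1$ as $x\to+\infty$ for every $\lambda>0$. Let $\alpha\in\mathbb{R}$ and let $b:(0,\infty)\to\mathbb{R}$ be given by $b(x)=x^{\alpha}\ell(x)$. Let $\sigma>0$ and let $\xi_0,\xi_1,\xi_2,\dots$ be independent isotropic complex Gaussian random variables with $\mathbb{E}[\xi_k]=0$ and $\mathbb{E}[|\xi_k|^2]=\sigma^2$; that is, $\Re\xi_k$ and $\Im\xi_k$ are independent centred real Gaussian variables, each with variance $\sigma^2/2$. For $m\in\mathbb{N}$ put $$K_m(z):=1+\sum_{k=1}^{m}b(k)\,\xi_k z^k+\sum_{k=1}^{m}b(k)\,\overline{\xi_k}\,z^{2m-k+1}+z^{2m+1},$$ and let $\nu_m$ be the number of zeros of $K_m$, counted with multiplicity, on the unit circle $\{z\in\mathbb{C}:|z|=1\}$. (i) If $\alpha\le -\tfrac12$, then $$\lim_{m\to\infty}\mathbb{E}\left[\frac{\nu_m}{2m+1}\right]=1.$$ (ii) If $\alpha>-\tfrac12$, then $$\lim_{m\to\infty}\mathbb{E}\left[\frac{\nu_m}{2m+1}\right]=\frac{1}{\sqrt{(1+\alpha)(3+2\alpha)}}<1.$$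 -/

import Mathlib

open MeasureTheory ProbabilityTheory Filter Topology Polynomial
open scoped NNReal ComplexConjugate

/-- A real function, of which only the values on `(0, ∞)` matter, is slowly varying at `+∞`:
it is measurable, eventually positive, and `ℓ (c x) / ℓ x → 1` as `x → +∞` for every `c > 0`. -/
structure IsSlowlyVarying (ℓ : ℝ → ℝ) : Prop where
  measurable : Measurable (fun x : Set.Ioi (0 : ℝ) => ℓ x)
  eventually_pos : ∀ᶠ x in atTop, 0 < ℓ x
  tendsto_ratio : ∀ c : ℝ, 0 < c → Tendsto (fun x => ℓ (c * x) / ℓ x) atTop (𝓝 1)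

/-- The centred isotropic (circularly symmetric) complex Gaussian law with `E|ξ|² = v`:
the real and imaginary parts are independent `N(0, v / 2)` variables. -/
noncomputable def isotropicComplexGaussian (v : ℝ≥0) : Measure ℂ :=
  ((gaussianReal 0 (v / 2)).prod (gaussianReal 0 (v / 2))).map
    (fun p : ℝ × ℝ => (p.1 : ℂ) + (p.2 : ℂ) * Complex.I)

/-- The self-inversive polynomial
`K_m(z) = 1 + ∑_{k=1}^m b(k) x_k z^k + ∑_{k=1}^m b(k) conj(x_k) z^{2m+1-k} + z^{2m+1}`. -/
noncomputable def selfInversivePoly (b : ℝ → ℝ) (x : ℕ → ℂ) (m : ℕ) : ℂ[X] :=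
  1 + ∑ k ∈ Finset.Icc 1 m, C ((b k : ℂ) * x k) * X ^ k
    + ∑ k ∈ Finset.Icc 1 m, C ((b k : ℂ) * conj (x k)) * X ^ (2 * m + 1 - k)
    + X ^ (2 * m + 1)

open Classical in
/-- The number of zeros of `p` on the unit circle, counted with multiplicity. -/
noncomputable def unitCircleZeroCount (p : ℂ[X]) : ℕ :=
  p.roots.countP (fun z => ‖z‖ = 1)

/-!
On the unit circle `K_m (exp (i t)) = 2 exp (i N t) F t` with `N = m + 1 / 2` and
`F t = cos (N t) + ∑ k ≤ m, b k * Re (ξ k * exp (-i (N - k) t))`, a real trigonometric sum with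
Gaussian coefficients. Almost surely all zeros of `F` are simple, so that the number of zeros of
`K_m` on the circle is the number of zeros of `F` in `[0, 2π)`
(`unitCircleZeroCount_eq_encard`, `ae_notMem_multipleZeroSet`).

The mean number of zeros is given by a Kac–Rice formula (`lintegral_encard_trigZeros`). Fix all
coefficients but one. The pairs of a zero `t` and a coordinate `η` parametrise the plane of values
of the remaining coefficient, and the fibre over such a value has as many points as `F` has zeros
(`zeroParam`, `encard_fiber_zeroParam`). The area formula with multiplicities
(`lintegral_encard_fiber_mul`) turns the mean over this coefficient into an integral over `t` and
`η`; the mean over the other coefficients is then computed with the rotation invariance of their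
law, which makes `F t` and `F' t` independent Gaussian variables with variances
`V = σ² / 2 * ∑ b k ^ 2` and `W = σ² / 2 * ∑ b k ^ 2 * (N - k) ^ 2`.

After division by `2 m + 1` the formula reads `zeroDensity V ρ N` with
`ρ ^ 2 = W / (N ^ 2 V) = (∑ b k ^ 2 * (1 - k / N) ^ 2) / ∑ b k ^ 2`. If `ρ = 1`, it is the mean
number of zeros of a random combination of `cos (N t)` and `sin (N t)`, which a.s. has `2 m + 1`
zeros: `zeroDensity V 1 N = 1` (`zeroDensity_one`). As `zeroDensity` is Lipschitz in `ρ`, the limit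
is `1` if `ρ → 1`; and if `V → ∞` then `zeroDensity V ρ N - ρ → 0`
(`abs_zeroDensity_sub_self_le`).

It remains to find the limit of `ρ`. The sequence `b k ^ 2` is regularly varying of index `2 α`, by
the uniform convergence theorem for slowly varying functions. Its partial sums `S` are regularly
varying of index `β = max (2 α + 1) 0` (`tendsto_partialSum_floor_div`), and they diverge if
`2 α + 1 > 0`. Since `ρ ^ 2` is the integral over `0 < x < 1` of `2 (1 - x) S (x N) / S m`, it
converges to `2 / ((β + 1) (β + 2))` (`tendsto_weighted_average`).
-/

/-! ### Slowly varying functions and regularly varying sequences -/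

/-- If the increments `h (x + u) - h x` of a measurable function tend to `0` as `x → ∞` for every
`u`, then they do so uniformly for bounded `u`. Pointwise convergence gives convergence in measure
on `[0, 4]`, along `x n` and along `x n + u n`; a common good point `x n + s` then
links `x n` to `x n + u n`. -/
theorem tendsto_sub_of_tendsto_shift {h : ℝ → ℝ} (hm : Measurable h)
    (hh : ∀ u, Tendsto (fun x => h (x + u) - h x) atTop (𝓝 0)) {x u : ℕ → ℝ}
    (hx : Tendsto x atTop atTop) (hu : ∀ᶠ n in atTop, |u n| ≤ 1) :
    Tendsto (fun n => h (x n + u n) - h (x n)) atTop (𝓝 0) := by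
  have key : ∀ y : ℕ → ℝ, Tendsto y atTop atTop → ∀ ε : ℝ, 0 < ε → ∀ᶠ n in atTop,
      volume {s ∈ Set.Icc (0 : ℝ) 4 | ε ≤ |h (y n + s) - h (y n)|} < 1 := by
    intro y hy ε hε
    have h1 : TendstoInMeasure (volume.restrict (Set.Icc (0 : ℝ) 4))
        (fun n s => h (y n + s) - h (y n)) atTop (fun _ => (0 : ℝ)) := by
      refine tendstoInMeasure_of_tendsto_ae (fun n => ?_) (ae_of_all _ fun s => (hh s).comp hy)
      exact ((hm.comp (measurable_const_add _)).sub_const _).aestronglyMeasurable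
    have h2 := h1 (ENNReal.ofReal ε) (by simpa using hε)
    filter_upwards [h2.eventually_lt_const (show (0 : ENNReal) < 1 by simp)] with n hn
    refine lt_of_le_of_lt ?_ hn
    rw [Measure.restrict_apply' measurableSet_Icc]
    refine measure_mono fun s hs => ⟨?_, hs.1⟩
    simp only [edist_dist, Set.mem_ofPred_eq, dist_zero_right, Real.norm_eq_abs]
    exact ENNReal.ofReal_le_ofReal hs.2
  have hy : Tendsto (fun n => x n + u n) atTop atTop := by
    refine tendsto_atTop_add_right_of_le' _ (-1) hx ?_
    filter_upwards [hu] with n hn using (abs_le.1 hn).1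
  rw [Metric.tendsto_nhds]
  intro ε hε
  filter_upwards [key x hx (ε / 2) (by positivity), key _ hy (ε / 2) (by positivity), hu]
    with n h1 h2 h3
  set B := {s ∈ Set.Icc (0 : ℝ) 4 | ε / 2 ≤ |h (x n + s) - h (x n)|} with hB
  set B' := {s ∈ Set.Icc (0 : ℝ) 4 | ε / 2 ≤ |h (x n + u n + s) - h (x n + u n)|} with hB'
  -- For `s ∈ [1, 3]` both `s` and `s - u n` lie in `[0, 4]`, and the two bad sets
  -- together have measure less than `2`.
  have h4 : ¬ Set.Icc (1 : ℝ) 3 ⊆ B ∪ (fun s => s + (- u n)) ⁻¹' B' := by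
    intro hsub
    have := (measure_mono (μ := volume) hsub).trans (measure_union_le _ _)
    rw [measure_preimage_add_right, Real.volume_Icc] at this
    have h5 := ENNReal.add_lt_add h1 h2
    refine absurd (this.trans_lt h5) ?_
    norm_num
  obtain ⟨s, hs, hs'⟩ := Set.not_subset.1 h4
  simp only [Set.mem_union, not_or, Set.mem_preimage] at hs'
  have h6 : |h (x n + s) - h (x n)| < ε / 2 := by
    by_contra hc
    exact hs'.1 ⟨⟨by linarith [hs.1], by linarith [hs.2]⟩, not_lt.1 hc⟩
  have h7 : |h (x n + u n + (s + - u n)) - h (x n + u n)| < ε / 2 := by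
    by_contra hc
    have := abs_le.1 h3
    exact hs'.2 ⟨⟨by linarith [hs.1], by linarith [hs.2]⟩, not_lt.1 hc⟩
  rw [show x n + u n + (s + - u n) = x n + s by ring] at h7
  rw [dist_zero_right, Real.norm_eq_abs]
  rw [abs_lt] at *
  constructor <;> linarith [h6.1, h6.2, h7.1, h7.2]

/-- The uniform convergence theorem for slowly varying functions, along sequences. -/
theorem IsSlowlyVarying.tendsto_div {ℓ : ℝ → ℝ} (hℓ : IsSlowlyVarying ℓ) {y z : ℕ → ℝ} {c : ℝ}
    (hc : 0 < c) (hy : Tendsto y atTop atTop) (hz : Tendsto (fun n => z n / y n) atTop (𝓝 c)) :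
    Tendsto (fun n => ℓ (z n) / ℓ (y n)) atTop (𝓝 1) := by
  set h : ℝ → ℝ := fun x => Real.log (ℓ (Real.exp x)) with hh
  have hm : Measurable h := by
    have : Measurable fun x : ℝ => (⟨Real.exp x, Real.exp_pos x⟩ : Set.Ioi (0 : ℝ)) :=
      Real.measurable_exp.subtype_mk
    exact Real.measurable_log.comp (hℓ.measurable.comp this)
  have hpos : ∀ᶠ x in atTop, 0 < ℓ (Real.exp x) :=
    Real.tendsto_exp_atTop.eventually hℓ.eventually_pos
  have hshift : ∀ u, Tendsto (fun x => h (x + u) - h x) atTop (𝓝 0) := by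
    intro u
    have h1 := (hℓ.tendsto_ratio (Real.exp u) (Real.exp_pos u)).comp Real.tendsto_exp_atTop
    have h2 := (Real.continuousAt_log one_ne_zero).tendsto.comp h1
    rw [Real.log_one] at h2
    refine h2.congr' ?_
    filter_upwards [hpos, (tendsto_atTop_add_const_right atTop u tendsto_id).eventually hpos]
      with x hx1 hx2
    simp only [Function.comp, hh, id] at *
    rw [Real.exp_add, mul_comm (Real.exp x)] at *
    rw [Real.log_div hx2.ne' hx1.ne']
  have hy0 : ∀ᶠ n in atTop, 0 < y n := hy.eventually_gt_atTop 0
  have hz0 : ∀ᶠ n in atTop, 0 < z n / y n := hz.eventually_const_lt hc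
  have hu : Tendsto (fun n => Real.log (z n / y n)) atTop (𝓝 (Real.log c)) :=
    (Real.continuousAt_log hc.ne').tendsto.comp hz
  have hly : Tendsto (fun n => Real.log (y n)) atTop atTop := Real.tendsto_log_atTop.comp hy
  have hx : Tendsto (fun n => Real.log (y n) + Real.log c) atTop atTop :=
    tendsto_atTop_add_const_right atTop _ hly
  have hu1 : ∀ᶠ n in atTop, |Real.log (z n / y n) - Real.log c| ≤ 1 := by
    have := (hu.sub_const (Real.log c)).abs
    simp only [sub_self, abs_zero] at this
    exact (this.eventually_lt_const zero_lt_one).mono fun _ => le_of_lt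
  have h1 := tendsto_sub_of_tendsto_shift hm hshift hx hu1
  have h2 := (hshift (Real.log c)).comp hly
  have h3 := (h1.add h2).rexp
  rw [add_zero, Real.exp_zero] at h3
  have hzt : Tendsto z atTop atTop := by
    refine (hy.atTop_mul_pos hc hz).congr' ?_
    filter_upwards [hy0] with n hn
    field_simp
  refine h3.congr' ?_
  filter_upwards [hy0, hz0, hzt.eventually_gt_atTop 0, hy.eventually hℓ.eventually_pos,
    hzt.eventually hℓ.eventually_pos] with n hn1 hn2 hn3 hn4 hn5
  simp only [hh, Function.comp]
  rw [Real.log_div hn3.ne' hn1.ne', show Real.log (y n) + Real.log c +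
    (Real.log (z n) - Real.log (y n) - Real.log c) = Real.log (z n) by ring, Real.exp_log hn3,
    Real.exp_log hn1]
  rw [show ∀ p q r : ℝ, p - q + (q - r) = p - r by intros; ring, Real.exp_sub,
    Real.exp_log hn5, Real.exp_log hn4]

/-- A nonnegative sequence is regularly varying of index `p`, in the uniform form
that `a (k n) / a n → c ^ p` whenever `k n / n → c > 0`. -/
structure IsRegularlyVaryingSeq (a : ℕ → ℝ) (p : ℝ) : Prop where
  nonneg : ∀ n, 0 ≤ a n
  eventually_pos : ∀ᶠ n in atTop, 0 < a n
  tendsto_div : ∀ (k : ℕ → ℕ) (c : ℝ), 0 < c →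
    Tendsto (fun n => (k n : ℝ) / n) atTop (𝓝 c) →
    Tendsto (fun n => a (k n) / a n) atTop (𝓝 (c ^ p))

theorem IsSlowlyVarying.isRegularlyVaryingSeq_sq {ℓ b : ℝ → ℝ} {α : ℝ} (hℓ : IsSlowlyVarying ℓ)
    (hb : ∀ x : ℝ, 0 < x → b x = x ^ α * ℓ x) :
    IsRegularlyVaryingSeq (fun n => b n ^ 2) (2 * α) where
  nonneg n := sq_nonneg _
  eventually_pos := by
    filter_upwards [tendsto_natCast_atTop_atTop.eventually hℓ.eventually_pos,
      eventually_gt_atTop 0] with n h1 h2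
    have h3 : (0 : ℝ) < n := by exact_mod_cast h2
    rw [hb _ h3]
    positivity
  tendsto_div k c hc hk := by
    have h1 := hℓ.tendsto_div hc tendsto_natCast_atTop_atTop hk
    have h2 := (hk.rpow_const (p := α) (Or.inl hc.ne')).mul h1
    have h3 := h2.pow 2
    rw [mul_one, ← Real.rpow_natCast, ← Real.rpow_mul hc.le] at h3
    rw [mul_comm 2 α]
    refine h3.congr' ?_
    filter_upwards [hk.eventually_const_lt hc, eventually_gt_atTop 0] with n h4 h5
    have h6 : (0 : ℝ) < n := by exact_mod_cast h5
    have h7 : (0 : ℝ) < k n := by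
      by_contra hcon
      have : (k n : ℝ) = 0 := le_antisymm (not_lt.1 hcon) (Nat.cast_nonneg _)
      simp [this] at h4
    rw [hb _ h6, hb _ h7, Real.div_rpow h7.le h6.le]
    rw [← div_pow, mul_div_mul_comm]

/-! ### Partial sums of regularly varying sequences -/

/-- The partial sum `a 1 + ⋯ + a n`. -/
def partialSum (a : ℕ → ℝ) (n : ℕ) : ℝ := ∑ i ∈ Finset.range n, a (i + 1)

/-- The piecewise linear interpolation of the partial sums `a 1 + ⋯ + a n`. -/
noncomputable def interpolatedSum (a : ℕ → ℝ) (y : ℝ) : ℝ :=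
  partialSum a ⌊y⌋₊ + (y - ⌊y⌋₊) * a (⌊y⌋₊ + 1)

theorem partialSum_succ (a : ℕ → ℝ) (n : ℕ) :
    partialSum a (n + 1) = partialSum a n + a (n + 1) :=
  Finset.sum_range_succ _ _

theorem partialSum_eq_sum_Icc (a : ℕ → ℝ) (n : ℕ) :
    partialSum a n = ∑ k ∈ Finset.Icc 1 n, a k := by
  rw [partialSum, Finset.range_eq_Ico, Finset.sum_Ico_add' a 0 n 1]
  rfl

theorem tendsto_floor_add_div {c : ℝ} (hc : 0 ≤ c) (d : ℝ) (hd : 0 ≤ d) (j : ℕ) :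
    Tendsto (fun n : ℕ => ((⌊c * (n + d)⌋₊ + j : ℕ) : ℝ) / n) atTop (𝓝 c) := by
  have h1 : Tendsto (fun n : ℕ => c + (c * d + j) / n) atTop (𝓝 c) := by
    simpa using tendsto_const_nhds.add
      (tendsto_const_nhds.div_atTop (tendsto_natCast_atTop_atTop (R := ℝ)))
  have h2 : Tendsto (fun n : ℕ => c - 1 / n) atTop (𝓝 c) := by
    simpa using (tendsto_const_nhds (x := c)).sub
      ((tendsto_const_nhds (x := (1 : ℝ))).div_atTop (tendsto_natCast_atTop_atTop (R := ℝ)))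
  refine tendsto_of_tendsto_of_tendsto_of_le_of_le' h2 h1 ?_ ?_
  · filter_upwards [eventually_gt_atTop 0] with n hn
    have hn' : (0 : ℝ) < n := by exact_mod_cast hn
    rw [le_div_iff₀ hn', sub_mul, div_mul_cancel₀ _ hn'.ne']
    push_cast
    have := Nat.lt_floor_add_one (c * (n + d))
    have : 0 ≤ c * d := by positivity
    have : (0 : ℝ) ≤ j := by positivity
    nlinarith
  · filter_upwards [eventually_gt_atTop 0] with n hn
    have hn' : (0 : ℝ) < n := by exact_mod_cast hn
    rw [div_le_iff₀ hn', add_mul, div_mul_cancel₀ _ hn'.ne']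
    push_cast
    have := Nat.floor_le (show 0 ≤ c * (n + d) by positivity)
    nlinarith

namespace IsRegularlyVaryingSeq

variable {a : ℕ → ℝ} {p : ℝ}

theorem partialSum_nonneg (ha : IsRegularlyVaryingSeq a p) (n : ℕ) : 0 ≤ partialSum a n :=
  Finset.sum_nonneg fun _ _ => ha.nonneg _

theorem partialSum_mono (ha : IsRegularlyVaryingSeq a p) : Monotone (partialSum a) :=
  monotone_nat_of_le_succ fun n => by rw [partialSum_succ]; linarith [ha.nonneg (n + 1)]

theorem eventually_partialSum_pos (ha : IsRegularlyVaryingSeq a p) :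
    ∀ᶠ n in atTop, 0 < partialSum a n := by
  filter_upwards [ha.eventually_pos, eventually_gt_atTop 0] with n hn h0
  obtain ⟨n, rfl⟩ := Nat.exists_eq_succ_of_ne_zero h0.ne'
  rw [Nat.succ_eq_add_one, partialSum_succ]
  linarith [ha.partialSum_nonneg n]

/-- A term of a regularly varying sequence is negligible against the partial sums, because
arbitrarily many of the preceding terms are comparable to it. -/
theorem tendsto_div_partialSum (ha : IsRegularlyVaryingSeq a p) :
    Tendsto (fun n => a n / partialSum a n) atTop (𝓝 0) := by
  have hinv : Tendsto (fun n => partialSum a n / a n) atTop atTop := by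
    rw [tendsto_atTop]
    intro B
    obtain ⟨J, hJ⟩ := exists_nat_gt B
    have h1 : ∀ j : ℕ, Tendsto (fun n => a (n - j) / a n) atTop (𝓝 1) := by
      intro j
      have := ha.tendsto_div (fun n => n - j) 1 one_pos ?_
      · simpa using this
      · have h2 : Tendsto (fun n : ℕ => 1 - (j : ℝ) / n) atTop (𝓝 1) := by
          simpa using (tendsto_const_nhds (x := (1 : ℝ))).sub
            ((tendsto_const_nhds (x := (j : ℝ))).div_atTop (tendsto_natCast_atTop_atTop (R := ℝ)))
        refine h2.congr' ?_
        filter_upwards [eventually_ge_atTop j, eventually_gt_atTop 0] with n hn hn0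
        have : (n : ℝ) ≠ 0 := by exact_mod_cast hn0.ne'
        rw [Nat.cast_sub hn, sub_div, div_self this]
    have h3 := tendsto_finsetSum (Finset.range J) (fun j _ => h1 j)
    simp only [Finset.sum_const, Finset.card_range, nsmul_eq_mul, mul_one] at h3
    filter_upwards [h3.eventually_const_lt hJ, ha.eventually_pos, eventually_ge_atTop J]
      with n h4 h5 h6
    refine h4.le.trans ?_
    rw [← Finset.sum_div]
    gcongr
    rw [partialSum, ← Finset.sum_range_reflect (fun i => a (i + 1)) n]
    calc ∑ j ∈ Finset.range J, a (n - j)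
        ≤ ∑ j ∈ Finset.range n, a (n - j) :=
          Finset.sum_le_sum_of_subset_of_nonneg (Finset.range_mono h6) fun _ _ _ => ha.nonneg _
      _ = _ := Finset.sum_congr rfl fun j hj => by
          rw [Finset.mem_range] at hj
          congr 1
          omega
  refine hinv.inv_tendsto_atTop.congr fun n => ?_
  simp

theorem tendsto_floor_div (ha : IsRegularlyVaryingSeq a p) {c : ℝ} (hc : 0 < c) {d : ℝ}
    (hd : 0 ≤ d) (j : ℕ) :
    Tendsto (fun n : ℕ => a (⌊c * (n + d)⌋₊ + j) / a n) atTop (𝓝 (c ^ p)) :=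
  ha.tendsto_div _ c hc (tendsto_floor_add_div hc.le d hd j)

/-- Over a step of length `c < 1` the interpolated sum grows by `c` times a convex
combination of two consecutive terms. -/
theorem exists_interpolatedSum_sub (a : ℕ → ℝ) {c : ℝ} (hc : 0 < c) (hc1 : c < 1) (n : ℕ) :
    ∃ θ : ℝ, 0 ≤ θ ∧ θ ≤ 1 ∧ interpolatedSum a (c * (n + 1 : ℕ)) - interpolatedSum a (c * n) =
      c * (θ * a (⌊c * n⌋₊ + 1) + (1 - θ) * a (⌊c * n⌋₊ + 2)) := by
  have h0 : 0 ≤ c * (n : ℝ) := by positivity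
  have h1 := Nat.floor_le h0
  have h2 := Nat.lt_floor_add_one (c * n)
  set k := ⌊c * (n : ℝ)⌋₊ with hk
  have e : c * ((n + 1 : ℕ) : ℝ) = c * n + c := by push_cast; ring
  rw [e]
  rcases lt_or_ge (c * n + c) (k + 1) with h | h
  · have hf : ⌊c * n + c⌋₊ = k := by
      rw [Nat.floor_eq_iff (by positivity)]
      exact ⟨by linarith, h⟩
    refine ⟨1, zero_le_one, le_rfl, ?_⟩
    rw [interpolatedSum, interpolatedSum, hf, ← hk]
    ring
  · have hf : ⌊c * n + c⌋₊ = k + 1 := by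
      rw [Nat.floor_eq_iff (by positivity)]
      push_cast
      exact ⟨by linarith, by linarith⟩
    refine ⟨(k + 1 - c * n) / c, div_nonneg (by linarith) hc.le, ?_, ?_⟩
    · rw [div_le_one hc]; linarith
    · rw [interpolatedSum, interpolatedSum, hf, ← hk, partialSum_succ]
      push_cast
      field_simp
      ring

/-- The increments of the interpolated sum along `c * n` are equivalent to `c ^ (p + 1)` times those
of the partial sums. Interpolation is needed here: the increments of the
partial sums at `⌊c * n⌋` are `0` for many `n`. -/
theorem isLittleO_interpolatedSum_sub (ha : IsRegularlyVaryingSeq a p) {c : ℝ} (hc : 0 < c)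
    (hc1 : c < 1) :
    (fun n : ℕ => interpolatedSum a (c * (n + 1 : ℕ)) - interpolatedSum a (c * n)
      - c ^ (p + 1) * a (n + 1)) =o[atTop] (fun n => a (n + 1)) := by
  have hs : Tendsto (fun n => a (n + 1) / a n) atTop (𝓝 1) := by
    simpa using ha.tendsto_floor_div one_pos le_rfl 1
  have hj : ∀ j : ℕ, Tendsto (fun n : ℕ => a (⌊c * n⌋₊ + j) / a (n + 1)) atTop (𝓝 (c ^ p)) := by
    intro j
    have h1 := (ha.tendsto_floor_div hc le_rfl j).div hs one_ne_zero
    rw [div_one] at h1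
    refine h1.congr' ?_
    filter_upwards [ha.eventually_pos] with n hn
    simp only [Pi.div_apply, add_zero]
    rw [div_div_div_cancel_right₀ hn.ne']
  choose θ hθ0 hθ1 hθ using exists_interpolatedSum_sub a hc hc1
  refine Asymptotics.isLittleO_of_tendsto' ?_ ?_
  · filter_upwards [(tendsto_add_atTop_nat 1).eventually ha.eventually_pos] with n hn h0
    exact absurd h0 hn.ne'
  have e1 := ((hj 1).sub_const (c ^ p)).abs
  have e2 := ((hj 2).sub_const (c ^ p)).abs
  have e3 := (e1.add e2).const_mul c
  simp only [sub_self, abs_zero, add_zero, mul_zero] at e3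
  refine squeeze_zero_norm' ?_ e3
  filter_upwards [(tendsto_add_atTop_nat 1).eventually ha.eventually_pos] with n hn
  rw [hθ]
  have e4 : (c * (θ n * a (⌊c * n⌋₊ + 1) + (1 - θ n) * a (⌊c * n⌋₊ + 2)) - c ^ (p + 1) * a (n + 1))
      / a (n + 1) = c * (θ n * (a (⌊c * n⌋₊ + 1) / a (n + 1) - c ^ p)
        + (1 - θ n) * (a (⌊c * n⌋₊ + 2) / a (n + 1) - c ^ p)) := by
    rw [Real.rpow_add_one hc.ne']
    field_simp
    ring
  rw [e4, Real.norm_eq_abs, abs_mul, abs_of_pos hc]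
  gcongr
  refine (abs_add_le _ _).trans ?_
  rw [abs_mul, abs_mul, abs_of_nonneg (hθ0 n), abs_of_nonneg (sub_nonneg.2 (hθ1 n))]
  gcongr
  · exact mul_le_of_le_one_left (abs_nonneg _) (hθ1 n)
  · exact mul_le_of_le_one_left (abs_nonneg _) (by linarith [hθ0 n])

theorem sum_interpolatedSum_sub (a : ℕ → ℝ) (c : ℝ) (m n : ℕ) (h : m ≤ n) :
    ∑ i ∈ Finset.Ico m n, (interpolatedSum a (c * (i + 1 : ℕ)) - interpolatedSum a (c * i)) =
      interpolatedSum a (c * n) - interpolatedSum a (c * m) :=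
  Finset.sum_Ico_sub (fun i : ℕ => interpolatedSum a (c * i)) h

theorem interpolatedSum_bounds (ha : IsRegularlyVaryingSeq a p) {y : ℝ} (hy : 0 ≤ y) :
    partialSum a ⌊y⌋₊ ≤ interpolatedSum a y ∧
      interpolatedSum a y ≤ partialSum a ⌊y⌋₊ + a (⌊y⌋₊ + 1) := by
  have h1 := Nat.floor_le hy
  have h2 := Nat.lt_floor_add_one y
  have h3 := ha.nonneg (⌊y⌋₊ + 1)
  rw [interpolatedSum]
  constructor <;> nlinarith

theorem tendsto_interpolatedSum_div (ha : IsRegularlyVaryingSeq a p)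
    (hS : Tendsto (partialSum a) atTop atTop) {c : ℝ} (hc : 0 < c) (hc1 : c < 1) :
    Tendsto (fun n : ℕ => interpolatedSum a (c * n) / partialSum a n) atTop
      (𝓝 (c ^ (p + 1))) := by
  have h1 := (ha.isLittleO_interpolatedSum_sub hc hc1).sum_range
    (fun n => ha.nonneg (n + 1)) hS
  have h2 := h1.tendsto_div_nhds_zero
  have h3 := h2.add_const (c ^ (p + 1))
  rw [zero_add] at h3
  refine h3.congr' ?_
  filter_upwards [ha.eventually_partialSum_pos] with n hn
  have h4 := sum_interpolatedSum_sub a c 0 n (Nat.zero_le n)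
  rw [← Finset.range_eq_Ico] at h4
  have h5 : interpolatedSum a (c * (0 : ℕ)) = 0 := by simp [interpolatedSum, partialSum]
  rw [Finset.sum_sub_distrib, h4, h5, ← Finset.mul_sum]
  change (interpolatedSum a (c * n) - 0 - c ^ (p + 1) * partialSum a n) / partialSum a n + _ = _
  field_simp
  ring

theorem floor_half_cases {c : ℝ} (hc : 0 < c) (hc1 : c < 1) (n : ℕ) :
    ⌊c * (n + 1 / 2)⌋₊ = ⌊c * n⌋₊ ∨ ⌊c * (n + 1 / 2)⌋₊ = ⌊c * n⌋₊ + 1 := by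
  have h0 : ⌊c * n⌋₊ ≤ ⌊c * (n + 1 / 2)⌋₊ := Nat.floor_mono (by gcongr; linarith)
  have h1 : ⌊c * (n + 1 / 2)⌋₊ ≤ ⌊c * n⌋₊ + 1 := by
    rw [← Nat.floor_add_one (by positivity)]
    exact Nat.floor_mono (by nlinarith)
  omega

theorem tendsto_partialSum_floor_div_of_atTop (ha : IsRegularlyVaryingSeq a p)
    (hS : Tendsto (partialSum a) atTop atTop) {c : ℝ} (hc : 0 < c) (hc1 : c < 1) :
    Tendsto (fun n : ℕ => partialSum a ⌊c * (n + 1 / 2)⌋₊ / partialSum a n) atTop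
      (𝓝 (c ^ (p + 1))) := by
  have h1 := ha.tendsto_interpolatedSum_div hS hc hc1
  have h2 := (ha.tendsto_floor_div hc le_rfl 1).mul ha.tendsto_div_partialSum
  rw [mul_zero] at h2
  have h3 : Tendsto (fun n : ℕ => partialSum a ⌊c * (n + 1 / 2)⌋₊ / partialSum a n
      - interpolatedSum a (c * n) / partialSum a n) atTop (𝓝 0) := by
    refine squeeze_zero_norm' ?_ h2
    filter_upwards [ha.eventually_partialSum_pos, ha.eventually_pos] with n hn hn'
    rw [← sub_div, norm_div, Real.norm_of_nonneg hn.le, add_zero, div_mul_div_cancel₀ hn'.ne',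
      Real.norm_eq_abs]
    gcongr
    obtain ⟨h4, h5⟩ := ha.interpolatedSum_bounds (show 0 ≤ c * (n : ℝ) by positivity)
    rw [abs_le]
    rcases floor_half_cases hc hc1 n with h6 | h6 <;> rw [h6]
    · constructor <;> linarith [ha.nonneg (⌊c * n⌋₊ + 1)]
    · rw [partialSum_succ]
      constructor <;> linarith [ha.nonneg (⌊c * n⌋₊ + 1)]
  simpa using h3.add h1

theorem partialSum_floor_le (ha : IsRegularlyVaryingSeq a p) {c : ℝ} (hc : 0 < c) (hc1 : c < 1)
    (n : ℕ) : partialSum a ⌊c * (n + 1 / 2)⌋₊ ≤ partialSum a n := by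
  refine ha.partialSum_mono (Nat.lt_succ_iff.1 ?_)
  rw [Nat.floor_lt (by positivity)]
  push_cast
  have : (0 : ℝ) ≤ n := by positivity
  nlinarith

/-- If the partial sums diverge, the ratio of `S (n / 2)` and `S n` tends to `2 ^ (-(p + 1))`; as it
is at most `1`, the exponent `p + 1` is nonnegative. -/
theorem index_nonneg_of_atTop (ha : IsRegularlyVaryingSeq a p)
    (hS : Tendsto (partialSum a) atTop atTop) : 0 ≤ p + 1 := by
  have h1 := ha.tendsto_partialSum_floor_div_of_atTop hS (c := 1 / 2) (by norm_num) (by norm_num)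
  have h2 : ((1 : ℝ) / 2) ^ (p + 1) ≤ 1 := by
    refine le_of_tendsto h1 ?_
    filter_upwards [ha.eventually_partialSum_pos] with n hn
    rw [div_le_one hn]
    exact ha.partialSum_floor_le (by norm_num) (by norm_num) n
  by_contra hneg
  have := Real.one_lt_rpow_of_pos_of_lt_one_of_neg (x := (1 : ℝ) / 2) (by norm_num) (by norm_num)
    (not_le.1 hneg)
  linarith

theorem tendsto_atTop_or (ha : IsRegularlyVaryingSeq a p) :
    Tendsto (partialSum a) atTop atTop ∨ ∃ L, 0 < L ∧ Tendsto (partialSum a) atTop (𝓝 L) := by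
  rcases tendsto_atTop_of_monotone ha.partialSum_mono with h | ⟨L, hL⟩
  · exact Or.inl h
  · obtain ⟨n, hn⟩ := ha.eventually_partialSum_pos.exists
    exact Or.inr ⟨L, hn.trans_le (ha.partialSum_mono.ge_of_tendsto hL n), hL⟩

/-- If `p + 1 > 0` the partial sums diverge. Otherwise the tail sums `T`, which
satisfy `T (c n) / T n → c ^ (p + 1) < 1`, would not be antitone. -/
theorem partialSum_tendsto_atTop (ha : IsRegularlyVaryingSeq a p) (hp : 0 < p + 1) :
    Tendsto (partialSum a) atTop atTop := by
  rcases ha.tendsto_atTop_or with h | ⟨L, hL0, hL⟩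
  · exact h
  exfalso
  have hc : (0 : ℝ) < 1 / 2 := by norm_num
  have hc1 : (1 / 2 : ℝ) < 1 := by norm_num
  set q : ℝ := (1 / 2) ^ (p + 1) with hq
  have hq1 : q < 1 := Real.rpow_lt_one hc.le hc1 hp
  have h1 := (ha.isLittleO_interpolatedSum_sub hc hc1).bound (show 0 < (1 - q) / 2 by linarith)
  obtain ⟨M, hM⟩ := eventually_atTop.1 (h1.and ha.eventually_pos)
  -- `m > 0` makes `⌊m / 2⌋ + 1 ≤ m`, so the interpolated sum at `m / 2` is at most the one at `m`.
  set m := M + 2 with hm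
  have hfl : Tendsto (fun n : ℕ => ⌊(1 / 2 : ℝ) * n⌋₊) atTop atTop :=
    tendsto_nat_floor_atTop.comp (tendsto_natCast_atTop_atTop.const_mul_atTop hc)
  have hF : ∀ n ≥ m, partialSum a ⌊(1 / 2 : ℝ) * n⌋₊ - interpolatedSum a (1 / 2 * m) ≤
      (1 + q) / 2 * (partialSum a n - partialSum a m) := by
    intro n hn
    have h2 := sum_interpolatedSum_sub a (1 / 2) m n hn
    have h3 : ∑ i ∈ Finset.Ico m n, (interpolatedSum a (1 / 2 * (i + 1 : ℕ))
        - interpolatedSum a (1 / 2 * i)) ≤ ∑ i ∈ Finset.Ico m n, (1 + q) / 2 * a (i + 1) := by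
      refine Finset.sum_le_sum fun i hi => ?_
      rw [Finset.mem_Ico] at hi
      have h4 := (hM i (by omega)).1
      rw [Real.norm_eq_abs, Real.norm_of_nonneg (ha.nonneg _)] at h4
      have := (abs_le.1 h4).2
      linarith
    rw [h2, ← Finset.mul_sum, Finset.sum_Ico_eq_sub _ hn] at h3
    have h5 := (ha.interpolatedSum_bounds (show 0 ≤ (1 / 2 : ℝ) * n by positivity)).1
    change _ ≤ (1 + q) / 2 * (partialSum a n - partialSum a m) at h3
    linarith
  have hlim : L - interpolatedSum a (1 / 2 * m) ≤ (1 + q) / 2 * (L - partialSum a m) :=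
    le_of_tendsto_of_tendsto ((hL.comp hfl).sub_const _) ((hL.sub_const _).const_mul _)
      ((eventually_ge_atTop m).mono fun n hn => hF n hn)
  have hup : interpolatedSum a (1 / 2 * m) ≤ partialSum a m := by
    refine (ha.interpolatedSum_bounds (by positivity)).2.trans ?_
    rw [← partialSum_succ]
    refine ha.partialSum_mono ?_
    have : ⌊(1 / 2 : ℝ) * m⌋₊ < m := by
      rw [Nat.floor_lt (by positivity)]
      have : (0 : ℝ) < m := by rw [hm]; positivity
      linarith
    omega
  have hpos : 0 < L - partialSum a m := by
    have h6 := ha.partialSum_mono.ge_of_tendsto hL (m + 1)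
    rw [partialSum_succ] at h6
    linarith [(hM (m + 1) (by omega)).2]
  nlinarith

/-- The partial sums of a regularly varying sequence of index `p` are
regularly varying of index `max (p + 1) 0`. -/
theorem tendsto_partialSum_floor_div (ha : IsRegularlyVaryingSeq a p) {c : ℝ} (hc : 0 < c)
    (hc1 : c < 1) :
    Tendsto (fun n : ℕ => partialSum a ⌊c * (n + 1 / 2)⌋₊ / partialSum a n) atTop
      (𝓝 (c ^ max (p + 1) 0)) := by
  rcases ha.tendsto_atTop_or with h | ⟨L, hL0, hL⟩
  · rw [max_eq_left (ha.index_nonneg_of_atTop h)]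
    exact ha.tendsto_partialSum_floor_div_of_atTop h hc hc1
  · have hp : p + 1 ≤ 0 := by
      by_contra hcon
      exact not_tendsto_nhds_of_tendsto_atTop (ha.partialSum_tendsto_atTop (not_le.1 hcon)) L hL
    have hfl : Tendsto (fun n : ℕ => ⌊c * ((n : ℝ) + 1 / 2)⌋₊) atTop atTop :=
      tendsto_nat_floor_atTop.comp
        ((tendsto_atTop_add_const_right _ _ tendsto_natCast_atTop_atTop).const_mul_atTop hc)
    have := (hL.comp hfl).div hL hL0.ne'
    rw [div_self hL0.ne'] at this
    rw [max_eq_right hp, Real.rpow_zero]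
    exact this

end IsRegularlyVaryingSeq

theorem sq_one_sub_eq_setIntegral {c : ℝ} (hc0 : 0 ≤ c) (hc1 : c ≤ 1) :
    (1 - c) ^ 2 = ∫ x in Set.Ioo (0 : ℝ) 1, (Set.Ici c).indicator (fun x => 2 * (1 - x)) x := by
  rw [← integral_Ioc_eq_integral_Ioo, setIntegral_indicator measurableSet_Ici,
    show ∫ x in Set.Ioc (0 : ℝ) 1 ∩ Set.Ici c, 2 * (1 - x) =
      ∫ x in Set.Ioc c 1, 2 * (1 - x) from ?_]
  · rw [← intervalIntegral.integral_of_le hc1]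
    rw [intervalIntegral.integral_const_mul, intervalIntegral.integral_sub (by simp) (by simp)]
    rw [intervalIntegral.integral_const, integral_id, smul_eq_mul]
    ring
  · refine setIntegral_congr_set ?_
    have h1 : (Set.Ioc (0 : ℝ) 1 ∩ Set.Ici c : Set ℝ) =ᵐ[volume]
        (Set.Ioc 0 1 ∩ Set.Ioi c : Set ℝ) :=
      (ae_eq_refl _).inter Ioi_ae_eq_Ici.symm
    refine h1.trans (Eq.eventuallyEq (Set.ext fun x => ?_))
    simp only [Set.mem_inter_iff, Set.mem_Ioc, Set.mem_Ioi]
    constructor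
    · rintro ⟨⟨_, h⟩, h'⟩; exact ⟨h', h⟩
    · rintro ⟨h', h⟩; exact ⟨⟨by linarith, h⟩, h'⟩

theorem setIntegral_two_mul_one_sub_mul_rpow {β : ℝ} (hβ : 0 ≤ β) :
    ∫ x in Set.Ioo (0 : ℝ) 1, 2 * (1 - x) * x ^ β = 2 / ((β + 1) * (β + 2)) := by
  rw [← integral_Ioc_eq_integral_Ioo, ← intervalIntegral.integral_of_le zero_le_one]
  have h1 : ∫ x in (0 : ℝ)..1, 2 * (1 - x) * x ^ β =
      ∫ x in (0 : ℝ)..1, (2 * x ^ β - 2 * x ^ (β + 1)) := by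
    refine intervalIntegral.integral_congr_ae (ae_of_all _ fun x hx => ?_)
    rw [Set.uIoc_of_le zero_le_one] at hx
    rw [Real.rpow_add_one hx.1.ne']
    ring
  rw [h1, intervalIntegral.integral_sub, intervalIntegral.integral_const_mul,
    intervalIntegral.integral_const_mul, integral_rpow (Or.inl (by linarith)),
    integral_rpow (Or.inl (by linarith)), Real.one_rpow, Real.one_rpow,
    Real.zero_rpow (by linarith), Real.zero_rpow (by linarith)]
  · field_simp
    ring
  · exact (intervalIntegral.intervalIntegrable_rpow' (by linarith)).const_mul _
  · exact (intervalIntegral.intervalIntegrable_rpow' (by linarith)).const_mul _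

/-- The averages of `(1 - k / N) ^ 2`, `N = m + 1 / 2`, against the weights `a k`, `k ≤ m`. -/
theorem IsRegularlyVaryingSeq.tendsto_weighted_average {a : ℕ → ℝ} {p : ℝ}
    (ha : IsRegularlyVaryingSeq a p) :
    Tendsto (fun m : ℕ => (∑ k ∈ Finset.Icc 1 m, a k * (1 - k / (m + 1 / 2)) ^ 2) / partialSum a m)
      atTop (𝓝 (2 / ((max (p + 1) 0 + 1) * (max (p + 1) 0 + 2)))) := by
  -- Write `(1 - k / N) ^ 2` as the integral of `2 (1 - x)` over `k / N ≤ x < 1` and exchange sum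
  -- and integral: the inner sum is over `k ≤ x N`.
  have key : ∀ m : ℕ, (∑ k ∈ Finset.Icc 1 m, a k * (1 - k / (m + 1 / 2)) ^ 2) / partialSum a m =
      ∫ x in Set.Ioo (0 : ℝ) 1,
        2 * (1 - x) * (partialSum a ⌊x * (m + 1 / 2)⌋₊ / partialSum a m) := by
    intro m
    have hN : (0 : ℝ) < m + 1 / 2 := by positivity
    have h1 : ∀ k ∈ Finset.Icc 1 m, a k * (1 - k / (m + 1 / 2)) ^ 2 =
        ∫ x in Set.Ioo (0 : ℝ) 1,
          a k * (Set.Ici ((k : ℝ) / (m + 1 / 2))).indicator (fun x => 2 * (1 - x)) x := by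
      intro k hk
      rw [Finset.mem_Icc] at hk
      have hkm : (k : ℝ) ≤ m := by exact_mod_cast hk.2
      rw [integral_const_mul, ← sq_one_sub_eq_setIntegral (by positivity)]
      rw [div_le_one hN]
      linarith
    rw [Finset.sum_congr rfl h1, ← integral_finsetSum, ← integral_div]
    · refine setIntegral_congr_fun measurableSet_Ioo fun x hx => ?_
      rw [← mul_div_assoc]
      congr 1
      rw [partialSum_eq_sum_Icc, Finset.mul_sum]
      have h2 : Finset.Icc 1 ⌊x * (m + 1 / 2)⌋₊ =
          (Finset.Icc 1 m).filter fun k : ℕ => (k : ℝ) / (m + 1 / 2) ≤ x := by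
        ext k
        simp only [Finset.mem_Icc, Finset.mem_filter]
        rw [Nat.le_floor_iff (mul_nonneg hx.1.le hN.le), div_le_iff₀ hN]
        refine ⟨fun h => ⟨⟨h.1, ?_⟩, h.2⟩, fun h => ⟨h.1.1, h.2⟩⟩
        have : (k : ℝ) < m + 1 := by nlinarith [hx.2, h.2]
        exact Nat.lt_succ_iff.1 (by exact_mod_cast this)
      rw [h2, Finset.sum_filter]
      refine Finset.sum_congr rfl fun k _ => ?_
      simp only [Set.indicator_apply, Set.mem_Ici]
      split_ifs <;> ring
    · intro k _
      refine ((Integrable.indicator ?_ measurableSet_Ici).const_mul _)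
      exact ((by fun_prop : Continuous fun x : ℝ => 2 * (1 - x)).integrableOn_Icc (a := 0)
        (b := 1)).mono_set Set.Ioo_subset_Icc_self
  simp_rw [key]
  rw [← setIntegral_two_mul_one_sub_mul_rpow (le_max_right _ _)]
  refine tendsto_integral_of_dominated_convergence (fun _ => 2) ?_ (by simp) ?_ ?_
  · intro m
    refine Measurable.aestronglyMeasurable ?_
    have : Measurable fun x : ℝ => partialSum a ⌊x * (m + 1 / 2)⌋₊ :=
      (measurable_from_nat (f := partialSum a)).comp
        (Nat.measurable_floor.comp (measurable_id.mul_const _))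
    fun_prop
  · intro m
    refine (ae_restrict_iff' measurableSet_Ioo).2 (ae_of_all _ fun x hx => ?_)
    rw [norm_mul, Real.norm_of_nonneg (by linarith [hx.2]), Real.norm_of_nonneg
      (div_nonneg (ha.partialSum_nonneg _) (ha.partialSum_nonneg _))]
    have h3 := div_le_one_of_le₀ (ha.partialSum_floor_le hx.1 hx.2 m) (ha.partialSum_nonneg m)
    have h4 : 0 ≤ partialSum a ⌊x * (m + 1 / 2)⌋₊ / partialSum a m :=
      div_nonneg (ha.partialSum_nonneg _) (ha.partialSum_nonneg _)
    nlinarith [hx.1, hx.2]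
  · refine (ae_restrict_iff' measurableSet_Ioo).2 (ae_of_all _ fun x hx => ?_)
    exact (ha.tendsto_partialSum_floor_div hx.1 hx.2).const_mul _

/-! ### The area formula with multiplicities -/

/-- If `f` is injective on each of the disjoint sets `t n`, the cardinality of a fibre of `f` in
their union is the number of images `f '' t n` that contain the point. -/
theorem encard_eq_tsum_indicator {ι X Y : Type*} [Countable ι] [MeasurableSpace X]
    [MeasurableSingletonClass X] {f : X → Y} {t : ι → Set X}
    (hd : Pairwise (fun i j => Disjoint (t i) (t j))) (hi : ∀ n, Set.InjOn f (t n)) (y : Y) :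
    (({x | x ∈ ⋃ n, t n ∧ f x = y}.encard : ℕ∞) : ENNReal) =
      ∑' n, (f '' t n).indicator (fun _ => (1 : ENNReal)) y := by
  have hsub : ∀ n, {x | x ∈ t n ∧ f x = y}.Subsingleton := fun n x hx z hz =>
    hi n hx.1 hz.1 (hx.2.trans hz.2.symm)
  have h1 : {x | x ∈ ⋃ n, t n ∧ f x = y} = ⋃ n, {x | x ∈ t n ∧ f x = y} := by
    ext x; simp
  have hm : ∀ n, MeasurableSet {x | x ∈ t n ∧ f x = y} := fun n => (hsub n).measurableSet
  rw [← Measure.count_apply (by rw [h1]; exact MeasurableSet.iUnion hm), h1,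
    measure_iUnion _ hm]
  · refine tsum_congr fun n => ?_
    rw [Measure.count_apply (hm n)]
    by_cases hy : y ∈ f '' t n
    · obtain ⟨x, hx, hxy⟩ := hy
      rw [Set.indicator_of_mem (Set.mem_image_of_mem f hx |> hxy.subst),
        (hsub n).eq_singleton_of_mem ⟨hx, hxy⟩, Set.encard_singleton]
      simp
    · rw [Set.indicator_of_notMem hy, Set.encard_eq_zero.2]
      · simp
      · ext x
        simp only [Set.mem_ofPred_eq, Set.mem_empty_iff_false, iff_false]
        exact fun h => hy ⟨x, h⟩
  · intro i j hij
    exact (hd hij).mono (fun x hx => hx.1) (fun x hx => hx.1)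

section AreaFormula

variable {E : Type*} [NormedAddCommGroup E] [NormedSpace ℝ E] [FiniteDimensional ℝ E]
  [MeasurableSpace E] [BorelSpace E] (μ : Measure E) [μ.IsAddHaarMeasure]
  {f : E → E} {f' : E → E →L[ℝ] E} {s : Set E}

/-- A set on which the differential of `f` is invertible is covered by countably many disjoint
measurable sets on each of which `f` is injective. -/
theorem exists_partition_injOn
    (hf' : ∀ x ∈ s, HasFDerivWithinAt f (f' x) s x) (h0 : ∀ x ∈ s, (f' x).det ≠ 0) :
    ∃ t : ℕ → Set E, Pairwise (fun i j => Disjoint (t i) (t j)) ∧ (∀ n, MeasurableSet (t n)) ∧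
      s ⊆ ⋃ n, t n ∧ ∀ n, Set.InjOn f (s ∩ t n) := by
  classical
  rcases s.eq_empty_or_nonempty with rfl | hs
  · exact ⟨fun _ => ∅, by simp [Pairwise], by simp, by simp, by simp⟩
  have hr : ∀ A : E →L[ℝ] E, ∃ r : ℝ≥0, r ≠ 0 ∧ (A.det ≠ 0 → ∀ u : Set E,
      ApproximatesLinearOn f A u r → Set.InjOn f u) := by
    intro A
    by_cases hA : A.det ≠ 0
    · let B := A.toContinuousLinearEquivOfDetNeZero hA
      have hB : (B : E →L[ℝ] E) = A := A.coe_toContinuousLinearEquivOfDetNeZero hA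
      rcases subsingleton_or_nontrivial E with hE | hE
      · exact ⟨1, one_ne_zero, fun _ u _ => Set.injOn_of_subsingleton f u⟩
      · have hpos : 0 < ‖(B.symm : E →L[ℝ] E)‖₊⁻¹ := inv_pos.2 B.nnnorm_symm_pos
        refine ⟨‖(B.symm : E →L[ℝ] E)‖₊⁻¹ / 2, (half_pos hpos).ne', fun _ u hu => ?_⟩
        rw [← hB] at hu
        exact hu.injOn (Or.inr (half_lt_self hpos))
    · exact ⟨1, one_ne_zero, fun h => absurd h hA⟩
  choose r hr0 hr1 using hr
  obtain ⟨t, A, ht1, ht2, ht3, ht4, ht5⟩ :=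
    exists_partition_approximatesLinearOn_of_hasFDerivWithinAt f s f' hf' r hr0
  refine ⟨t, ht1, ht2, ht3, fun n => ?_⟩
  obtain ⟨y, hy, hAy⟩ := ht5 hs n
  exact hr1 (A n) (hAy ▸ h0 y hy) _ (ht4 n)

/-- The area formula in equal dimensions: a change of variables without injectivity, in which
points of the target are counted with the cardinality of their fibres. -/
theorem lintegral_encard_fiber_mul (hs : MeasurableSet s)
    (hf' : ∀ x ∈ s, HasFDerivWithinAt f (f' x) s x) (hdet : Measurable fun x => (f' x).det)
    {g : E → ENNReal} (hg : Measurable g) :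
    ∫⁻ y, (({x | x ∈ s ∧ f x = y}.encard : ℕ∞) : ENNReal) * g y ∂μ =
      ∫⁻ x in s, ENNReal.ofReal |(f' x).det| * g (f x) ∂μ := by
  set s₀ := s ∩ {x | (f' x).det = 0} with hs₀
  set s₁ := s ∩ {x | (f' x).det ≠ 0} with hs₁
  have hz : MeasurableSet {x | (f' x).det = 0} := hdet (measurableSet_singleton 0)
  have ms₀ : MeasurableSet s₀ := hs.inter hz
  have ms₁ : MeasurableSet s₁ := hs.inter hz.compl
  have hf₁ : ∀ x ∈ s₁, HasFDerivWithinAt f (f' x) s₁ x := fun x hx =>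
    (hf' x hx.1).mono Set.inter_subset_left
  have hunion : s = s₀ ∪ s₁ := (Set.inter_union_compl s _).symm
  have hdisj : Disjoint s₀ s₁ := by
    rw [Set.disjoint_left]
    exact fun x hx hx' => hx'.2 hx.2
  -- By Sard's lemma the points where `f'` is not invertible do not matter.
  have hnull : μ (f '' s₀) = 0 :=
    addHaar_image_eq_zero_of_det_fderivWithin_eq_zero μ
      (fun x hx => (hf' x hx.1).mono Set.inter_subset_left) fun x hx => hx.2
  obtain ⟨t, ht1, ht2, ht3, ht4⟩ := exists_partition_injOn hf₁ fun x hx => hx.2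
  have hcover : s₁ = ⋃ n, s₁ ∩ t n := by
    rw [← Set.inter_iUnion, Set.inter_eq_left.2 ht3]
  have hd : Pairwise (fun i j => Disjoint (s₁ ∩ t i) (s₁ ∩ t j)) := fun i j hij =>
    (ht1 hij).mono Set.inter_subset_right Set.inter_subset_right
  have hmt : ∀ n, MeasurableSet (s₁ ∩ t n) := fun n => ms₁.inter (ht2 n)
  have hft : ∀ n, ∀ x ∈ s₁ ∩ t n, HasFDerivWithinAt f (f' x) (s₁ ∩ t n) x := fun n x hx =>
    (hf₁ x hx.1).mono Set.inter_subset_left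
  have hcount : ∀ᵐ y ∂μ, (({x | x ∈ s ∧ f x = y}.encard : ℕ∞) : ENNReal) =
      ∑' n, (f '' (s₁ ∩ t n)).indicator (fun _ => (1 : ENNReal)) y := by
    have : ∀ᵐ y ∂μ, y ∉ f '' s₀ := measure_eq_zero_iff_ae_notMem.1 hnull
    filter_upwards [this] with y hy
    rw [← encard_eq_tsum_indicator hd ht4, ← hcover]
    have e : {x | x ∈ s ∧ f x = y} = {x | x ∈ s₁ ∧ f x = y} := by
      refine Set.ext fun x => and_congr_left fun hx => ?_
      rw [hunion, Set.mem_union]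
      exact ⟨fun h => h.resolve_left fun h0 => hy ⟨x, h0, hx⟩, Or.inr⟩
    rw [e]
  have hmi : ∀ n, MeasurableSet (f '' (s₁ ∩ t n)) := fun n =>
    measurable_image_of_fderivWithin (hmt n) (hft n) (ht4 n)
  calc ∫⁻ y, (({x | x ∈ s ∧ f x = y}.encard : ℕ∞) : ENNReal) * g y ∂μ
      = ∫⁻ y, ∑' n, (f '' (s₁ ∩ t n)).indicator g y ∂μ := by
        refine lintegral_congr_ae ?_
        filter_upwards [hcount] with y hy
        rw [hy, ← ENNReal.tsum_mul_right]
        refine tsum_congr fun n => ?_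
        by_cases h : y ∈ f '' (s₁ ∩ t n) <;> simp [h]
    _ = ∑' n, ∫⁻ y in f '' (s₁ ∩ t n), g y ∂μ := by
        rw [lintegral_tsum fun n => (hg.indicator (hmi n)).aemeasurable]
        exact tsum_congr fun n => lintegral_indicator (hmi n) _
    _ = ∑' n, ∫⁻ x in s₁ ∩ t n, ENNReal.ofReal |(f' x).det| * g (f x) ∂μ :=
        tsum_congr fun n =>
          lintegral_image_eq_lintegral_abs_det_fderiv_mul μ (hmt n) (hft n) (ht4 n) g
    _ = ∫⁻ x in s₁, ENNReal.ofReal |(f' x).det| * g (f x) ∂μ := by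
        conv_rhs => rw [hcover]
        rw [lintegral_iUnion hmt hd]
    _ = ∫⁻ x in s, ENNReal.ofReal |(f' x).det| * g (f x) ∂μ := by
        conv_rhs => rw [hunion]
        rw [lintegral_union ms₁ hdisj, setLIntegral_congr_fun ms₀ (g := fun _ => 0)]
        · simp
        · intro x hx
          have : (f' x).det = 0 := hx.2
          simp [this]

end AreaFormula

/-! ### Trigonometric sums and zeros on the unit circle -/

theorem isClosed_setOf_exists_mem_compact {X : Type*} [TopologicalSpace X] {A : Set (X × ℝ)}
    (hA : IsClosed A) {K : Set ℝ} (hK : IsCompact K) : IsClosed {x | ∃ t ∈ K, (x, t) ∈ A} := by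
  have := isCompact_iff_compactSpace.1 hK
  have h1 : IsClosed {p : X × K | (p.1, (p.2 : ℝ)) ∈ A} :=
    hA.preimage (continuous_fst.prodMk (continuous_subtype_val.comp continuous_snd))
  have h2 := isClosedMap_fst_of_compactSpace _ h1
  convert h2 using 1
  ext x
  simp

theorem measurableSet_setOf_exists_mem_Ico {X : Type*} [TopologicalSpace X] [MeasurableSpace X]
    [OpensMeasurableSpace X] {A : Set (X × ℝ)} (hA : IsClosed A) (a b : ℝ) :
    MeasurableSet {x | ∃ t ∈ Set.Ico a b, (x, t) ∈ A} := by
  have h1 : {x | ∃ t ∈ Set.Ico a b, (x, t) ∈ A} =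
      ⋃ n : ℕ, {x | ∃ t ∈ Set.Icc a (b - 1 / (n + 1)), (x, t) ∈ A} := by
    ext x
    simp only [Set.mem_ofPred_eq, Set.mem_iUnion]
    constructor
    · rintro ⟨t, ht, hx⟩
      obtain ⟨n, hn⟩ := exists_nat_one_div_lt (sub_pos.2 ht.2)
      exact ⟨n, t, ⟨ht.1, by linarith⟩, hx⟩
    · rintro ⟨n, t, ht, hx⟩
      have : (0 : ℝ) < 1 / (n + 1) := by positivity
      exact ⟨t, ⟨ht.1, by linarith [ht.2]⟩, hx⟩
  rw [h1]
  exact MeasurableSet.iUnion fun n =>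
    (isClosed_setOf_exists_mem_compact hA isCompact_Icc).measurableSet

/-- The cardinality of a set of nonnegative reals is the supremum, over `n`, of the number of
cells `[j / n, (j + 1) / n)` that it meets. -/
theorem encard_eq_iSup_floor {Z : Set ℝ} (hZ : ∀ t ∈ Z, 0 ≤ t) :
    Z.encard = ⨆ n : ℕ, ((fun t : ℝ => ⌊t * n⌋₊) '' Z).encard := by
  refine le_antisymm ?_ (iSup_le fun n => Set.encard_image_le _ _)
  refine ENat.forall_natCast_le_iff_le.1 fun k hk => ?_
  obtain ⟨F, hFZ, hF⟩ := Set.exists_subset_encard_eq hk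
  have hfin : F.Finite := Set.finite_of_encard_eq_coe hF
  have h1 : ∀ᶠ n : ℕ in atTop, ∀ p ∈ F ×ˢ F, p.1 ≠ p.2 → 1 < |p.1 - p.2| * n := by
    rw [Set.Finite.eventually_all (hfin.prod hfin)]
    intro p _
    by_cases h : p.1 = p.2
    · simp [h]
    · have h2 : 0 < |p.1 - p.2| := abs_pos.2 (sub_ne_zero.2 h)
      filter_upwards [(tendsto_natCast_atTop_atTop.const_mul_atTop h2).eventually_gt_atTop 1]
        with n hn _ using hn
  obtain ⟨n, hn⟩ := h1.exists
  have hinj : Set.InjOn (fun t : ℝ => ⌊t * n⌋₊) F := by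
    intro a ha b hb hab
    by_contra hne
    have h3 := hn (a, b) ⟨ha, hb⟩ hne
    have ha0 : 0 ≤ a * n := mul_nonneg (hZ a (hFZ ha)) (Nat.cast_nonneg _)
    have hb0 : 0 ≤ b * n := mul_nonneg (hZ b (hFZ hb)) (Nat.cast_nonneg _)
    have h4 := Nat.floor_le ha0
    have h5 := Nat.floor_le hb0
    have h6 := Nat.lt_floor_add_one (a * n)
    have h7 := Nat.lt_floor_add_one (b * n)
    simp only at hab h3
    rw [hab] at h4 h6
    have h8 : |a - b| * n = |a * n - b * n| := by
      rw [← sub_mul, abs_mul, abs_of_nonneg (Nat.cast_nonneg (α := ℝ) n)]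
    rw [h8] at h3
    refine absurd h3 (not_lt.2 (abs_le.2 ⟨?_, ?_⟩)) <;> linarith
  calc (k : ℕ∞) = ((fun t : ℝ => ⌊t * n⌋₊) '' F).encard := by rw [hinj.encard_image, hF]
    _ ≤ ((fun t : ℝ => ⌊t * n⌋₊) '' Z).encard := Set.encard_mono (Set.image_mono hFZ)
    _ ≤ _ := le_iSup (fun n : ℕ => ((fun t : ℝ => ⌊t * n⌋₊) '' Z).encard) n

/-- The number of zeros in `[0, T)` of a continuous function is measurable in parameters on which
the function depends continuously. -/
theorem measurable_encard_zeros {X : Type*} [TopologicalSpace X] [MeasurableSpace X]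
    [OpensMeasurableSpace X] {G : X → ℝ → ℝ} (hG : Continuous fun p : X × ℝ => G p.1 p.2)
    (T : ℝ) :
    Measurable fun x => (({t | t ∈ Set.Ico 0 T ∧ G x t = 0}.encard : ℕ∞) : ENNReal) := by
  have hA : IsClosed {p : X × ℝ | G p.1 p.2 = 0} := isClosed_eq hG continuous_const
  have h1 : ∀ x, (({t | t ∈ Set.Ico 0 T ∧ G x t = 0}.encard : ℕ∞) : ENNReal) =
      ⨆ n : ℕ, ∑' j : ℕ, {x | ∃ t ∈ Set.Ico 0 T, ⌊t * n⌋₊ = j ∧ G x t = 0}.indicator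
        (fun _ => (1 : ENNReal)) x := by
    intro x
    rw [encard_eq_iSup_floor fun t ht => ht.1.1, ENat.toENNReal_iSup]
    refine iSup_congr fun n => ?_
    rw [← Measure.count_apply MeasurableSet.of_discrete,
      Measure.count_apply MeasurableSet.of_discrete, ← ENNReal.tsum_set_one,
      tsum_subtype _ fun _ => (1 : ENNReal)]
    refine tsum_congr fun j => ?_
    by_cases h : x ∈ {x | ∃ t ∈ Set.Ico 0 T, ⌊t * n⌋₊ = j ∧ G x t = 0}
    · rw [Set.indicator_of_mem h]
      obtain ⟨t, h1, h3, h2⟩ := h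
      have hj : j ∈ (fun t : ℝ => ⌊t * n⌋₊) '' {t | t ∈ Set.Ico 0 T ∧ G x t = 0} :=
        ⟨t, ⟨h1, h2⟩, h3⟩
      exact Set.indicator_of_mem hj _
    · rw [Set.indicator_of_notMem h]
      refine Set.indicator_of_notMem ?_ _
      rintro ⟨t, ⟨h1, h2⟩, h3⟩
      exact h ⟨t, h1, h3, h2⟩
  simp_rw [h1]
  refine Measurable.iSup fun n => Measurable.tsum fun j => ?_
  refine measurable_const.indicator ?_
  -- For `n = 0` the only cell is the whole line, with `j = 0`.
  rcases Nat.eq_zero_or_pos n with rfl | hn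
  · by_cases hj : j = 0
    · subst hj
      simpa using measurableSet_setOf_exists_mem_Ico hA 0 T
    · simp [Ne.symm hj]
  · have hn' : (0 : ℝ) < n := by exact_mod_cast hn
    have h2 : {x | ∃ t ∈ Set.Ico 0 T, ⌊t * n⌋₊ = j ∧ G x t = 0} =
        {x | ∃ t ∈ Set.Ico (max 0 (j / n : ℝ)) (min T ((j + 1) / n)),
          (x, t) ∈ {p : X × ℝ | G p.1 p.2 = 0}} := by
      refine Set.ext fun x => exists_congr fun t => ?_
      simp only [Set.mem_Ico, Set.mem_ofPred_eq, max_le_iff, lt_min_iff, div_le_iff₀ hn',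
        lt_div_iff₀ hn']
      constructor
      · rintro ⟨h3, h4, h5⟩
        have := (Nat.floor_eq_iff (mul_nonneg h3.1 hn'.le)).1 h4
        exact ⟨⟨⟨h3.1, this.1⟩, h3.2, this.2⟩, h5⟩
      · rintro ⟨⟨⟨h3, h4⟩, h5, h6⟩, h7⟩
        exact ⟨⟨h3, h5⟩, (Nat.floor_eq_iff (mul_nonneg h3 hn'.le)).2 ⟨h4, h6⟩, h7⟩
    rw [h2]
    exact measurableSet_setOf_exists_mem_Ico hA _ _

/-- The real trigonometric sum `cos (N t) + ∑ b k * Re (x k * exp (-i κ k t))`, `k ∈ s`. -/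
noncomputable def trigSum (N : ℝ) (s : Finset ℕ) (b κ : ℕ → ℝ) (x : ℕ → ℂ) (t : ℝ) : ℝ :=
  Real.cos (N * t) +
    ∑ k ∈ s, b k * ((x k).re * Real.cos (κ k * t) + (x k).im * Real.sin (κ k * t))

/-- The derivative of `trigSum` in the variable `t`. -/
noncomputable def trigSumDeriv (N : ℝ) (s : Finset ℕ) (b κ : ℕ → ℝ) (x : ℕ → ℂ) (t : ℝ) : ℝ :=
  -N * Real.sin (N * t) +
    ∑ k ∈ s, b k * κ k * (-(x k).re * Real.sin (κ k * t) + (x k).im * Real.cos (κ k * t))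

section TrigSum

variable (N : ℝ) (s : Finset ℕ) (b κ : ℕ → ℝ)

theorem hasDerivAt_trigSum (x : ℕ → ℂ) (t : ℝ) :
    HasDerivAt (trigSum N s b κ x) (trigSumDeriv N s b κ x t) t := by
  have hlin : ∀ c : ℝ, HasDerivAt (fun t : ℝ => c * t) c t := fun c => by
    simpa using (hasDerivAt_id t).const_mul c
  unfold trigSum trigSumDeriv
  refine HasDerivAt.add ?_ (HasDerivAt.fun_sum fun k _ => ?_)
  · exact (hlin N).cos.congr_deriv (by ring)
  · exact ((((hlin (κ k)).cos.const_mul (x k).re).add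
      ((hlin (κ k)).sin.const_mul (x k).im)).const_mul (b k)).congr_deriv (by ring)

theorem continuous_trigSum :
    Continuous fun p : (ℕ → ℂ) × ℝ => trigSum N s b κ p.1 p.2 := by
  unfold trigSum; fun_prop

theorem continuous_trigSumDeriv :
    Continuous fun p : (ℕ → ℂ) × ℝ => trigSumDeriv N s b κ p.1 p.2 := by
  unfold trigSumDeriv; fun_prop

/-- The zeros of `trigSum` in the period `[0, 2π)`. -/
def trigZeros (x : ℕ → ℂ) : Set ℝ :=
  {t | t ∈ Set.Ico 0 (2 * Real.pi) ∧ trigSum N s b κ x t = 0}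

theorem measurable_encard_trigZeros :
    Measurable fun x => (((trigZeros N s b κ x).encard : ℕ∞) : ENNReal) :=
  measurable_encard_zeros (continuous_trigSum N s b κ) _

/-- The coefficients for which `trigSum` has a multiple zero. -/
def multipleZeroSet : Set (ℕ → ℂ) :=
  {x | ∃ t ∈ Set.Ico 0 (2 * Real.pi), trigSum N s b κ x t = 0 ∧ trigSumDeriv N s b κ x t = 0}

theorem measurableSet_multipleZeroSet : MeasurableSet (multipleZeroSet N s b κ) :=
  measurableSet_setOf_exists_mem_Ico
    ((isClosed_eq (continuous_trigSum N s b κ) continuous_const).inter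
      (isClosed_eq (continuous_trigSumDeriv N s b κ) continuous_const)) 0 (2 * Real.pi)

end TrigSum

/-- On the unit circle the self-inversive polynomial is, up to a factor without zeros, a real
trigonometric sum. -/
theorem eval_selfInversivePoly (b : ℝ → ℝ) (x : ℕ → ℂ) (m : ℕ) (t : ℝ) :
    (selfInversivePoly b x m).eval (Complex.exp (t * Complex.I)) =
      2 * Complex.exp (((m + 1 / 2 : ℝ) * t : ℝ) * Complex.I) *
        (trigSum (m + 1 / 2) (Finset.Icc 1 m) (fun k => b k) (fun k => m + 1 / 2 - k) x t : ℝ) := by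
  set N : ℝ := m + 1 / 2 with hN
  have hexp : ∀ θ : ℝ, Complex.exp (θ * Complex.I) = Real.cos θ + Real.sin θ * Complex.I := by
    intro θ; rw [Complex.exp_mul_I]; simp
  have hpow : ∀ j : ℕ, Complex.exp (t * Complex.I) ^ j =
      Complex.exp ((N * t : ℝ) * Complex.I) * Complex.exp (((j - N) * t : ℝ) * Complex.I) := by
    intro j
    rw [← Complex.exp_nat_mul, ← Complex.exp_add]
    congr 1
    push_cast
    ring
  have h0 : (1 : ℂ) = Complex.exp ((N * t : ℝ) * Complex.I) *
      Complex.exp ((-(N * t) : ℝ) * Complex.I) := by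
    rw [← Complex.exp_add]; push_cast; simp
  have h1 : Complex.exp (t * Complex.I) ^ (2 * m + 1) = Complex.exp ((N * t : ℝ) * Complex.I) *
      Complex.exp ((N * t : ℝ) * Complex.I) := by
    rw [hpow]
    congr 3
    rw [hN]; push_cast; ring
  rw [selfInversivePoly]
  simp only [eval_add, eval_one, eval_finsetSum, eval_mul, eval_C, eval_pow, eval_X]
  rw [h1, trigSum]
  nth_rewrite 1 [h0]
  have h2 : ∀ k ∈ Finset.Icc 1 m,
      (b k : ℂ) * conj (x k) * Complex.exp (t * Complex.I) ^ (2 * m + 1 - k) =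
        Complex.exp ((N * t : ℝ) * Complex.I) *
        ((b k : ℂ) * conj (x k) * Complex.exp (((N - k) * t : ℝ) * Complex.I)) := by
    intro k hk
    rw [Finset.mem_Icc] at hk
    rw [hpow, Nat.cast_sub (by omega)]
    have : (((2 * m + 1 : ℕ) : ℝ) - k - N) * t = (N - k) * t := by rw [hN]; push_cast; ring
    rw [this]; ring
  have h3 : ∀ k ∈ Finset.Icc 1 m, (b k : ℂ) * x k * Complex.exp (t * Complex.I) ^ k
      = Complex.exp ((N * t : ℝ) * Complex.I) *
        ((b k : ℂ) * x k * Complex.exp ((-((N - k) * t) : ℝ) * Complex.I)) := by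
    intro k _
    rw [hpow]
    have : (k - N) * t = -((N - k) * t) := by ring
    rw [this]; ring
  rw [Finset.sum_congr rfl h2, Finset.sum_congr rfl h3, ← Finset.mul_sum, ← Finset.mul_sum,
    ← mul_add, ← mul_add, ← mul_add, mul_assoc 2, mul_left_comm 2]
  congr 1
  push_cast
  rw [mul_add, Finset.mul_sum]
  rw [show ∀ a b c d : ℂ, a + b + c + d = (a + d) + (b + c) by intros; ring,
    ← Finset.sum_add_distrib]
  congr 1
  · have e1 := hexp (-(N * t))
    have e2 := hexp (N * t)
    push_cast at e1 e2
    rw [e1, e2, Complex.cos_neg, Complex.sin_neg]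
    ring
  · refine Finset.sum_congr rfl fun k _ => ?_
    have e1 := hexp (-((N - k) * t))
    have e2 := hexp ((N - k) * t)
    push_cast at e1 e2
    rw [e1, e2, Complex.cos_neg, Complex.sin_neg]
    conv_lhs => rw [← Complex.re_add_im (x k)]
    simp only [map_add, map_mul, Complex.conj_ofReal, Complex.conj_I]
    linear_combination (-2 * (b k : ℂ) * (x k).im * Complex.sin ((N - k) * t)) * Complex.I_sq

theorem Complex.bijOn_exp_mul_I_Ico :
    Set.BijOn (fun t : ℝ => Complex.exp (t * Complex.I)) (Set.Ico 0 (2 * Real.pi))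
      {z | ‖z‖ = 1} := by
  refine ⟨fun t _ => Complex.norm_exp_ofReal_mul_I t, ?_, ?_⟩
  · intro a ha b hb hab
    obtain ⟨n, hn⟩ := Complex.exp_eq_exp_iff_exists_int.1 hab
    have h1 : (a : ℂ) = b + n * (2 * Real.pi) := by
      refine mul_right_cancel₀ Complex.I_ne_zero (hn.trans ?_)
      ring
    have h2 : a = b + n * (2 * Real.pi) := by exact_mod_cast h1
    have hpi := Real.pi_pos
    have h3 : (n : ℝ) < 1 := by
      by_contra h; nlinarith [ha.1, ha.2, hb.1, hb.2]
    have h4 : (-1 : ℝ) < n := by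
      by_contra h; nlinarith [ha.1, ha.2, hb.1, hb.2]
    have h5 : n = 0 := by
      have h6 : n < 1 := by exact_mod_cast h3
      have h7 : -1 < n := by exact_mod_cast h4
      omega
    simpa [h5] using h2
  · intro z hz
    have hz1 : Complex.exp (z.arg * Complex.I) = z := by
      have := Complex.norm_mul_exp_arg_mul_I z
      rwa [show ‖z‖ = 1 from hz, Complex.ofReal_one, one_mul] at this
    have h1 := Complex.neg_pi_lt_arg z
    have h2 := Complex.arg_le_pi z
    have hpi := Real.pi_pos
    rcases le_or_gt 0 z.arg with h | h
    · exact ⟨z.arg, ⟨h, by linarith⟩, hz1⟩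
    · refine ⟨z.arg + 2 * Real.pi, ⟨by linarith, by linarith⟩, ?_⟩
      simp only
      push_cast
      rw [add_mul, Complex.exp_add, hz1, Complex.exp_two_pi_mul_I, mul_one]

theorem selfInversivePoly_ne_zero (b : ℝ → ℝ) (x : ℕ → ℂ) (m : ℕ) :
    selfInversivePoly b x m ≠ 0 := by
  have h1 : (selfInversivePoly b x m).eval 0 = 1 := by
    rw [selfInversivePoly]
    simp only [eval_add, eval_one, eval_finsetSum, eval_mul, eval_C, eval_pow, eval_X]
    rw [Finset.sum_eq_zero, Finset.sum_eq_zero]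
    · simp
    · intro k hk
      rw [Finset.mem_Icc] at hk
      rw [zero_pow (by omega), mul_zero]
    · intro k hk
      rw [Finset.mem_Icc] at hk
      rw [zero_pow (by omega), mul_zero]
  intro h
  simp [h] at h1

/-- If all the zeros of the trigonometric sum are simple, they correspond to the zeros of the
polynomial on the unit circle, counted with multiplicity. -/
theorem unitCircleZeroCount_eq_encard (b : ℝ → ℝ) (x : ℕ → ℂ) (m : ℕ)
    (hx : x ∉ multipleZeroSet (m + 1 / 2) (Finset.Icc 1 m) (fun k => b k)
      (fun k => m + 1 / 2 - k)) :
    (unitCircleZeroCount (selfInversivePoly b x m) : ℕ∞) =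
      (trigZeros (m + 1 / 2) (Finset.Icc 1 m) (fun k => b k) (fun k => m + 1 / 2 - k) x).encard := by
  classical
  set p := selfInversivePoly b x m with hp
  set F := trigSum (m + 1 / 2) (Finset.Icc 1 m) (fun k => b k) (fun k => m + 1 / 2 - k) x with hF
  set N : ℝ := m + 1 / 2 with hN
  have hp0 : p ≠ 0 := selfInversivePoly_ne_zero b x m
  have hroot : ∀ t : ℝ, p.IsRoot (Complex.exp (t * Complex.I)) ↔ F t = 0 := by
    intro t
    rw [IsRoot, hp, eval_selfInversivePoly]
    simp [Complex.exp_ne_zero, hF, hN]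
  have hsimple : ∀ t ∈ Set.Ico 0 (2 * Real.pi), F t = 0 →
      p.rootMultiplicity (Complex.exp (t * Complex.I)) ≤ 1 := by
    intro t ht hFt
    by_contra hcon
    have h1 := (one_lt_rootMultiplicity_iff_isRoot hp0).1 (not_le.1 hcon)
    refine hx ⟨t, ht, hFt, ?_⟩
    -- Differentiate `p (exp (i t)) = 2 exp (i N t) F t` at a common zero of `p` and its derivative.
    have hexp : ∀ c : ℝ, HasDerivAt (fun t : ℝ => Complex.exp ((c * t : ℝ) * Complex.I))
        (Complex.exp ((c * t : ℝ) * Complex.I) * (c * Complex.I)) t := by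
      intro c
      have h2 : HasDerivAt (fun t : ℝ => ((c * t : ℝ) : ℂ) * Complex.I) (c * Complex.I) t := by
        have := ((hasDerivAt_id t).const_mul c).ofReal_comp.mul_const Complex.I
        simpa using this
      exact h2.cexp
    have h3 : HasDerivAt (fun t : ℝ => p.eval (Complex.exp ((1 * t : ℝ) * Complex.I)))
        (p.derivative.eval (Complex.exp ((1 * t : ℝ) * Complex.I)) * _) t :=
      (p.hasDerivAt _).comp t (hexp 1)
    have h4 := ((hexp N).const_mul 2).mul (hasDerivAt_trigSum N (Finset.Icc 1 m) (fun k => b k)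
      (fun k => N - k) x t).ofReal_comp
    have h5 : (fun t : ℝ => p.eval (Complex.exp ((1 * t : ℝ) * Complex.I))) =
        (fun t : ℝ => 2 * Complex.exp ((N * t : ℝ) * Complex.I)) *
          fun t : ℝ =>
            ((trigSum N (Finset.Icc 1 m) (fun k => b k) (fun k => N - k) x t : ℝ) : ℂ) := by
      funext t
      simp only [one_mul, Pi.mul_apply]
      rw [hp, eval_selfInversivePoly]
    rw [h5] at h3
    have h6 := h3.unique h4
    have h7 : p.derivative.eval (Complex.exp ((1 * t : ℝ) * Complex.I)) = 0 := by
      have := h1.2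
      rw [IsRoot] at this
      rw [one_mul]
      exact this
    have h8 : trigSum N (Finset.Icc 1 m) (fun k => b k) (fun k => N - k) x t = 0 := hFt
    rw [h7, h8] at h6
    simp [Complex.exp_ne_zero] at h6
    exact h6
  have hnodup : (p.roots.filter fun z => ‖z‖ = 1).Nodup := by
    rw [Multiset.nodup_iff_count_le_one]
    intro z
    by_cases hz : ‖z‖ = 1
    · rw [Multiset.count_filter_of_pos (p := fun z : ℂ => ‖z‖ = 1) hz, count_roots]
      obtain ⟨t, ht, rfl⟩ := Complex.bijOn_exp_mul_I_Ico.surjOn hz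
      by_cases hFt : F t = 0
      · exact hsimple t ht hFt
      · rw [rootMultiplicity_eq_zero fun h => hFt ((hroot t).1 h)]
        exact zero_le_one
    · rw [Multiset.count_filter_of_neg (p := fun z : ℂ => ‖z‖ = 1) hz]
      exact zero_le_one
  have himg : (fun t : ℝ => Complex.exp (t * Complex.I)) '' (trigZeros N (Finset.Icc 1 m)
      (fun k => b k) (fun k => N - k) x) =
        ((p.roots.filter fun z => ‖z‖ = 1).toFinset : Set ℂ) := by
    ext z
    simp only [Set.mem_image, Finset.mem_coe, Multiset.mem_toFinset, Multiset.mem_filter,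
      mem_roots hp0]
    constructor
    · rintro ⟨t, ⟨ht, hFt⟩, rfl⟩
      exact ⟨(hroot t).2 hFt, Complex.norm_exp_ofReal_mul_I t⟩
    · rintro ⟨h1, h2⟩
      obtain ⟨t, ht, rfl⟩ := Complex.bijOn_exp_mul_I_Ico.surjOn h2
      exact ⟨t, ⟨ht, (hroot t).1 h1⟩, rfl⟩
  rw [← (Complex.bijOn_exp_mul_I_Ico.injOn.mono fun t ht => ht.1).encard_image, himg,
    Set.encard_coe_eq_coe_finsetCard, unitCircleZeroCount, Multiset.countP_eq_card_filter,
    Multiset.toFinset_card_of_nodup hnodup]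

/-! ### Isotropic complex Gaussian variables -/

instance (v : ℝ≥0) : IsProbabilityMeasure (isotropicComplexGaussian v) :=
  Measure.isProbabilityMeasure_map (by fun_prop)

theorem charFun_isotropicComplexGaussian (v : ℝ≥0) (w : ℂ) :
    charFun (isotropicComplexGaussian v) w =
      Complex.exp (-(v * (w.re ^ 2 + w.im ^ 2) / 4 : ℝ)) := by
  rw [charFun_apply, isotropicComplexGaussian, integral_map (by fun_prop)
    (Continuous.aestronglyMeasurable (by fun_prop))]
  have h1 : ∀ p : ℝ × ℝ, Complex.exp (inner ℝ ((p.1 : ℂ) + (p.2 : ℂ) * Complex.I) w * Complex.I) =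
      Complex.exp (w.re * p.1 * Complex.I) * Complex.exp (w.im * p.2 * Complex.I) := by
    intro p
    rw [← Complex.exp_add, Complex.inner]
    congr 1
    simp
    ring
  simp_rw [h1]
  rw [integral_prod_mul (f := fun x : ℝ => Complex.exp (w.re * x * Complex.I))
    (g := fun x : ℝ => Complex.exp (w.im * x * Complex.I)), ← charFun_apply_real,
    ← charFun_apply_real, charFun_gaussianReal, charFun_gaussianReal, ← Complex.exp_add]
  congr 1
  push_cast
  ring

/-- Independent isotropic complex Gaussian variables keep their joint law after a rotation of each
of them, so the two linear combinations below are independent centred Gaussian variables. -/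
theorem map_rotated_sums_eq_prod {Ω : Type*} [MeasurableSpace Ω] {P : Measure Ω}
    [IsProbabilityMeasure P] {v : ℝ≥0} {ξ : ℕ → Ω → ℂ} (hm : ∀ k, Measurable (ξ k))
    (hindep : iIndepFun ξ P) (hlaw : ∀ k, P.map (ξ k) = isotropicComplexGaussian v)
    (s : Finset ℕ) (β δ θ : ℕ → ℝ) :
    P.map (fun ω =>
      (∑ k ∈ s, β k * ((ξ k ω).re * Real.cos (θ k) + (ξ k ω).im * Real.sin (θ k)),
       ∑ k ∈ s, δ k * (-(ξ k ω).re * Real.sin (θ k) + (ξ k ω).im * Real.cos (θ k)))) =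
    (gaussianReal 0 (v / 2 * ∑ k ∈ s, ‖β k‖₊ ^ 2)).prod
      (gaussianReal 0 (v / 2 * ∑ k ∈ s, ‖δ k‖₊ ^ 2)) := by
  set S : Ω → ℝ := fun ω =>
    ∑ k ∈ s, β k * ((ξ k ω).re * Real.cos (θ k) + (ξ k ω).im * Real.sin (θ k))
  set T : Ω → ℝ := fun ω =>
    ∑ k ∈ s, δ k * (-(ξ k ω).re * Real.sin (θ k) + (ξ k ω).im * Real.cos (θ k))
  have hS : Measurable S := by fun_prop
  have hT : Measurable T := by fun_prop
  have : IsProbabilityMeasure (P.map fun ω => (S ω, T ω)) :=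
    Measure.isProbabilityMeasure_map (hS.prodMk hT).aemeasurable
  refine charFun_eq_prod_iff.1 fun t => ?_
  set a : ℝ := (WithLp.ofLp t).1
  set c : ℝ := (WithLp.ofLp t).2
  -- The pairing of `t` with the two sums is a sum of inner products of `ξ k` and `w k`.
  let w : ℕ → ℂ := fun k =>
    ⟨a * β k * Real.cos (θ k) - c * δ k * Real.sin (θ k),
      a * β k * Real.sin (θ k) + c * δ k * Real.cos (θ k)⟩
  let Y : ℕ → Ω → ℝ := fun k ω => inner ℝ (ξ k ω) (w k)
  have hYm : ∀ k, Measurable (Y k) := fun k => by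
    change Measurable ((fun z : ℂ => inner ℝ z (w k)) ∘ ξ k)
    exact (Continuous.measurable (by fun_prop)).comp (hm k)
  have hY : iIndepFun Y P :=
    hindep.comp (fun k z => inner ℝ z (w k)) fun k => (Continuous.measurable (by fun_prop))
  have hsum : ∀ ω, ∑ k ∈ s, Y k ω = S ω * a + T ω * c := by
    intro ω
    simp only [S, T, Y, w, Complex.inner, Finset.sum_mul]
    rw [← Finset.sum_add_distrib]
    refine Finset.sum_congr rfl fun k _ => ?_
    simp
    ring
  have h1 : charFun ((P.map fun ω => (S ω, T ω)).map (WithLp.toLp 2)) t =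
      charFun (P.map fun ω => ∑ k ∈ s, Y k ω) 1 := by
    rw [charFun_apply, charFun_apply_real, Measure.map_map (by fun_prop) (by fun_prop),
      integral_map (by fun_prop) (Continuous.aestronglyMeasurable (by fun_prop)),
      integral_map (by fun_prop) (Continuous.aestronglyMeasurable (by fun_prop))]
    refine integral_congr_ae (ae_of_all _ fun ω => ?_)
    simp only [hsum, Function.comp, WithLp.prod_inner_apply]
    simp
    congr 2
    rw [mul_comm (S ω : ℂ), mul_comm (T ω : ℂ)]
    rfl
  have h2 : ∀ k, charFun (P.map (Y k)) 1 =
      Complex.exp (-(v * (a ^ 2 * β k ^ 2 + c ^ 2 * δ k ^ 2) / 4 : ℝ)) := by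
    intro k
    have h3 : charFun (P.map (Y k)) 1 = charFun (P.map (ξ k)) (w k) := by
      rw [charFun_apply_real, charFun_apply, integral_map (hYm k).aemeasurable
        (Continuous.aestronglyMeasurable (by fun_prop)), integral_map (hm k).aemeasurable
        (Continuous.aestronglyMeasurable (by fun_prop))]
      simp [Y]
    rw [h3, hlaw, charFun_isotropicComplexGaussian]
    congr 4
    simp only [w]
    linear_combination v * (a ^ 2 * β k ^ 2 + c ^ 2 * δ k ^ 2) * Real.sin_sq_add_cos_sq (θ k)
  rw [h1, iIndepFun.charFun_map_fun_finsetSum_eq_prod (fun k _ => (hYm k).aemeasurable)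
    (hY.restrict s), Finset.prod_apply, Finset.prod_congr rfl fun k _ => h2 k,
    ← Complex.exp_sum, charFun_gaussianReal, charFun_gaussianReal, ← Complex.exp_add]
  congr 1
  push_cast
  rw [Finset.sum_neg_distrib]
  simp only [← Complex.ofReal_pow, Real.norm_eq_abs, sq_abs]
  push_cast
  simp only [Finset.mul_sum, Finset.sum_mul, Finset.sum_div, mul_zero, zero_mul, zero_sub]
  rw [← neg_add, ← Finset.sum_add_distrib]
  congr 1
  refine Finset.sum_congr rfl fun k _ => ?_
  ring

/-- A centred Gaussian average of a Gaussian density is the Gaussian density of the sum of the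
variances, pointwise. -/
theorem lintegral_gaussianPDF_add (V w : ℝ≥0) (hw : w ≠ 0) (c : ℝ) :
    ∫⁻ s, gaussianPDF 0 w (c + s) ∂(gaussianReal 0 V) = gaussianPDF 0 (V + w) c := by
  rcases eq_or_ne V 0 with rfl | hV
  · rw [gaussianReal_zero_var, lintegral_dirac' _ (by fun_prop)]
    simp
  have hV' : (0 : ℝ) < V := by exact_mod_cast pos_iff_ne_zero.2 hV
  have hw' : (0 : ℝ) < w := by exact_mod_cast pos_iff_ne_zero.2 hw
  have hU : V * w / (V + w) ≠ 0 := by positivity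
  -- Completing the square in `s`.
  have key : ∀ s, gaussianPDF 0 V s * gaussianPDF 0 w (c + s) =
      gaussianPDF 0 (V + w) c * gaussianPDF (-(c * V / (V + w))) (V * w / (V + w)) s := by
    intro s
    simp only [gaussianPDF]
    rw [← ENNReal.ofReal_mul (gaussianPDFReal_nonneg _ _ _),
      ← ENNReal.ofReal_mul (gaussianPDFReal_nonneg _ _ _)]
    congr 1
    simp only [gaussianPDFReal]
    rw [mul_mul_mul_comm (√(2 * Real.pi * V))⁻¹,
      mul_mul_mul_comm (√(2 * Real.pi * (V + w : ℝ≥0)))⁻¹, ← Real.exp_add, ← Real.exp_add,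
      ← mul_inv, ← mul_inv,
      ← Real.sqrt_mul (by positivity), ← Real.sqrt_mul (by positivity)]
    congr 2
    · congr 1
      push_cast
      field_simp
    · push_cast
      field_simp
      ring
  rw [gaussianReal_of_var_ne_zero _ hV, lintegral_withDensity_eq_lintegral_mul _ (by fun_prop)
    (by fun_prop)]
  simp only [Pi.mul_apply, key]
  rw [lintegral_const_mul _ (by fun_prop), lintegral_gaussianPDF_eq_one _ hU, mul_one]

/-! ### The Kac–Rice formula -/

/-- By independence, one of the variables may be averaged separately. -/
theorem lintegral_eq_lintegral_update {Ω : Type*} [MeasurableSpace Ω] {P : Measure Ω}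
    [IsProbabilityMeasure P] {ξ : ℕ → Ω → ℂ} (hm : ∀ k, Measurable (ξ k))
    (hindep : iIndepFun ξ P) (k₀ : ℕ) {f : (ℕ → ℂ) → ENNReal} (hf : Measurable f) :
    ∫⁻ ω, f (fun k => ξ k ω) ∂P =
      ∫⁻ ω, ∫⁻ z, f (Function.update (fun k => ξ k ω) k₀ z) ∂(P.map (ξ k₀)) ∂P := by
  set O : Ω → ℕ → ℂ := fun ω => Function.update (fun k => ξ k ω) k₀ 0 with hO
  have hOm : Measurable O := by
    refine measurable_pi_lambda _ fun k => ?_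
    by_cases h : k = k₀
    · subst h; simp [hO]
    · simpa [hO, Function.update_of_ne h] using hm k
  have hupd : Measurable fun p : ℂ × (ℕ → ℂ) => Function.update p.2 k₀ p.1 := by
    refine measurable_pi_lambda _ fun k => ?_
    by_cases h : k = k₀
    · subst h; simpa using measurable_fst
    · simp only [Function.update_of_ne h]
      exact (measurable_pi_apply k).comp measurable_snd
  have hind : IndepFun (ξ k₀) O P := by
    have h1 := indep_iSup_of_disjoint (fun k => (hm k).comap_le) hindep
      (S := {k₀}) (T := {k₀}ᶜ) disjoint_compl_right
    refine indep_of_indep_of_le_left (indep_of_indep_of_le_right h1 ?_) ?_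
    · refine Measurable.comap_le ?_
      refine @measurable_pi_lambda _ _ _ (_) _ _ fun k => ?_
      by_cases h : k = k₀
      · subst h; simp [hO]
      · simp only [hO, Function.update_of_ne h]
        refine Measurable.mono (comap_measurable (ξ k)) ?_ le_rfl
        exact le_iSup₂_of_le k h le_rfl
    · exact le_iSup₂_of_le k₀ rfl le_rfl
  have hprod := (indepFun_iff_map_prod_eq_prod_map_map (hm k₀).aemeasurable hOm.aemeasurable).1 hind
  have h2 : ∀ ω, f (fun k => ξ k ω) = f (Function.update (O ω) k₀ (ξ k₀ ω)) := by
    intro ω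
    simp [hO]
  have hfu : Measurable fun p : ℂ × (ℕ → ℂ) => f (Function.update p.2 k₀ p.1) := hf.comp hupd
  simp_rw [h2]
  rw [← lintegral_map (f := fun p : ℂ × (ℕ → ℂ) => f (Function.update p.2 k₀ p.1)) hfu
    ((hm k₀).prodMk hOm), hprod, lintegral_prod_symm _ hfu.aemeasurable,
    lintegral_map (hfu.lintegral_prod_left') hOm]
  simp [hO]

section KacRice

variable (N : ℝ) (s : Finset ℕ) (b κ : ℕ → ℝ) (x : ℕ → ℂ) (k₀ : ℕ)

theorem trigSum_update (hk : k₀ ∈ s) (p q t : ℝ) :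
    trigSum N s b κ (Function.update x k₀ (p + q * Complex.I)) t =
      trigSum N (s.erase k₀) b κ x t +
        b k₀ * (p * Real.cos (κ k₀ * t) + q * Real.sin (κ k₀ * t)) := by
  unfold trigSum
  rw [← Finset.sum_erase_add _ _ hk, ← add_assoc]
  congr 1
  · congr 1
    refine Finset.sum_congr rfl fun k hk' => ?_
    rw [Function.update_of_ne (Finset.ne_of_mem_erase hk')]
  · simp

theorem trigSumDeriv_update (hk : k₀ ∈ s) (p q t : ℝ) :
    trigSumDeriv N s b κ (Function.update x k₀ (p + q * Complex.I)) t =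
      trigSumDeriv N (s.erase k₀) b κ x t +
        b k₀ * κ k₀ * (-p * Real.sin (κ k₀ * t) + q * Real.cos (κ k₀ * t)) := by
  unfold trigSumDeriv
  rw [← Finset.sum_erase_add _ _ hk, ← add_assoc]
  congr 1
  · congr 1
    refine Finset.sum_congr rfl fun k hk' => ?_
    rw [Function.update_of_ne (Finset.ne_of_mem_erase hk')]
  · simp

/-- For fixed values of the other coefficients, the pairs `(t, η)` parametrise the values
`p + q i` of the `k₀`-th coefficient for which `t` is a zero of the trigonometric sum: this value
lies on a line orthogonal to `(cos (κ t), sin (κ t))`, and `η` is the coordinate along it. -/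
noncomputable def zeroParam (z : ℝ × ℝ) : ℝ × ℝ :=
  (-(trigSum N (s.erase k₀) b κ x z.1 / b k₀) * Real.cos (κ k₀ * z.1)
      - z.2 * Real.sin (κ k₀ * z.1),
   -(trigSum N (s.erase k₀) b κ x z.1 / b k₀) * Real.sin (κ k₀ * z.1)
      + z.2 * Real.cos (κ k₀ * z.1))

/-- The differential of `zeroParam`. -/
noncomputable def zeroParamDeriv (z : ℝ × ℝ) : ℝ × ℝ →L[ℝ] ℝ × ℝ :=
  (Matrix.toLin (.finTwoProd ℝ) (.finTwoProd ℝ)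
    !![-(trigSumDeriv N (s.erase k₀) b κ x z.1 / b k₀) * Real.cos (κ k₀ * z.1)
          + trigSum N (s.erase k₀) b κ x z.1 / b k₀ * κ k₀ * Real.sin (κ k₀ * z.1)
          - z.2 * κ k₀ * Real.cos (κ k₀ * z.1), -Real.sin (κ k₀ * z.1);
       -(trigSumDeriv N (s.erase k₀) b κ x z.1 / b k₀) * Real.sin (κ k₀ * z.1)
          - trigSum N (s.erase k₀) b κ x z.1 / b k₀ * κ k₀ * Real.cos (κ k₀ * z.1)
          - z.2 * κ k₀ * Real.sin (κ k₀ * z.1), Real.cos (κ k₀ * z.1)]).toContinuousLinearMap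

theorem hasFDerivAt_zeroParam (z : ℝ × ℝ) :
    HasFDerivAt (zeroParam N s b κ x k₀) (zeroParamDeriv N s b κ x k₀ z) z := by
  unfold zeroParamDeriv
  rw [Matrix.toLin_finTwoProd_toContinuousLinearMap]
  have hA := ((hasDerivAt_trigSum N (s.erase k₀) b κ x z.1).div_const (b k₀)).neg
  have hlin : HasDerivAt (fun t : ℝ => κ k₀ * t) (κ k₀) z.1 := by
    simpa using (hasDerivAt_id z.1).const_mul (κ k₀)
  have h1 := ((hA.mul hlin.cos).comp_hasFDerivAt z hasFDerivAt_fst).sub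
    ((hasFDerivAt_snd (𝕜 := ℝ) (p := z)).mul (hlin.sin.comp_hasFDerivAt z hasFDerivAt_fst))
  have h2 := ((hA.mul hlin.sin).comp_hasFDerivAt z hasFDerivAt_fst).add
    ((hasFDerivAt_snd (𝕜 := ℝ) (p := z)).mul (hlin.cos.comp_hasFDerivAt z hasFDerivAt_fst))
  refine (h1.prodMk h2).congr_fderiv ?_
  ext <;> simp <;> ring

theorem det_zeroParamDeriv (z : ℝ × ℝ) :
    (zeroParamDeriv N s b κ x k₀ z).det =
      -(trigSumDeriv N (s.erase k₀) b κ x z.1 / b k₀ + κ k₀ * z.2) := by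
  rw [zeroParamDeriv, ContinuousLinearMap.det, LinearMap.coe_toContinuousLinearMap,
    LinearMap.det_toLin, Matrix.det_fin_two_of]
  linear_combination (-(trigSumDeriv N (s.erase k₀) b κ x z.1 / b k₀) - κ k₀ * z.2) *
    Real.sin_sq_add_cos_sq (κ k₀ * z.1)

theorem measurable_det_zeroParamDeriv :
    Measurable fun z => (zeroParamDeriv N s b κ x k₀ z).det := by
  simp_rw [det_zeroParamDeriv]
  have := (continuous_trigSumDeriv N (s.erase k₀) b κ).comp
    (Continuous.prodMk (continuous_const (y := x)) (continuous_fst (X := ℝ) (Y := ℝ)))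
  exact ((this.measurable.div_const _).add (measurable_snd.const_mul _)).neg

variable {N s b κ k₀}

theorem zeroParam_eq_iff (hb : b k₀ ≠ 0) (hk : k₀ ∈ s) (t η p q : ℝ) :
    zeroParam N s b κ x k₀ (t, η) = (p, q) ↔
      trigSum N s b κ (Function.update x k₀ (p + q * Complex.I)) t = 0 ∧
        η = -p * Real.sin (κ k₀ * t) + q * Real.cos (κ k₀ * t) := by
  rw [trigSum_update N s b κ x k₀ hk, zeroParam, Prod.mk.injEq]
  set A := trigSum N (s.erase k₀) b κ x t
  have h := Real.sin_sq_add_cos_sq (κ k₀ * t)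
  set S := Real.sin (κ k₀ * t)
  set C := Real.cos (κ k₀ * t)
  have hA : A = b k₀ * (A / b k₀) := by field_simp
  set a := A / b k₀
  simp only
  constructor
  · rintro ⟨h1, h2⟩
    constructor
    · rw [← h1, ← h2, hA]; linear_combination (-(b k₀) * a) * h
    · rw [← h1, ← h2]; linear_combination (-η) * h
  · rintro ⟨h1, h2⟩
    have h3 : a = -(p * C + q * S) := by
      rw [hA, ← mul_add] at h1
      linarith [(mul_eq_zero.1 h1).resolve_left hb]
    rw [h3, h2]
    constructor
    · linear_combination p * h
    · linear_combination q * h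

/-- The fibres of `zeroParam` count the zeros of the trigonometric sum. -/
theorem encard_fiber_zeroParam (hb : b k₀ ≠ 0) (hk : k₀ ∈ s) (y : ℝ × ℝ) :
    {z | z ∈ Set.Ico 0 (2 * Real.pi) ×ˢ Set.univ ∧ zeroParam N s b κ x k₀ z = y}.encard =
      (trigZeros N s b κ (Function.update x k₀ (y.1 + y.2 * Complex.I))).encard := by
  obtain ⟨p, q⟩ := y
  have hinj : Set.InjOn Prod.fst {z : ℝ × ℝ | z ∈ Set.Ico 0 (2 * Real.pi) ×ˢ Set.univ ∧
      zeroParam N s b κ x k₀ z = (p, q)} := by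
    rintro ⟨t, η⟩ ⟨_, h1⟩ ⟨t', η'⟩ ⟨_, h2⟩ h
    simp only at h
    subst h
    rw [((zeroParam_eq_iff x hb hk _ _ _ _).1 h1).2, ((zeroParam_eq_iff x hb hk _ _ _ _).1 h2).2]
  rw [← hinj.encard_image]
  congr 1
  refine Set.ext fun t => ⟨?_, fun ht => ?_⟩
  · rintro ⟨⟨t, η⟩, ⟨h1, h2⟩, rfl⟩
    exact ⟨h1.1, ((zeroParam_eq_iff x hb hk _ _ _ _).1 h2).1⟩
  · exact ⟨(t, _), ⟨⟨ht.1, trivial⟩, (zeroParam_eq_iff x hb hk _ _ _ _).2 ⟨ht.2, rfl⟩⟩, rfl⟩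

theorem gaussianReal_prod_eq_withDensity {v : ℝ≥0} (hv : v ≠ 0) :
    (gaussianReal 0 v).prod (gaussianReal 0 v) =
      (volume : Measure (ℝ × ℝ)).withDensity
        fun y => gaussianPDF 0 v y.1 * gaussianPDF 0 v y.2 := by
  rw [gaussianReal_of_var_ne_zero _ hv, prod_withDensity (by fun_prop) (by fun_prop)]
  rfl

/-- A multiple zero corresponds to a critical point of `zeroParam`, and the critical values form a
null set by Sard's lemma. -/
theorem ae_update_notMem_multipleZeroSet {u : ℝ≥0} (hu : u ≠ 0) (hb : b k₀ ≠ 0) (hk : k₀ ∈ s) :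
    ∀ᵐ z ∂(isotropicComplexGaussian u), Function.update x k₀ z ∉ multipleZeroSet N s b κ := by
  have hu2 : u / 2 ≠ 0 := by positivity
  have hms : MeasurableSet {z : ℂ | Function.update x k₀ z ∉ multipleZeroSet N s b κ} := by
    refine MeasurableSet.compl ?_
    exact (measurable_update x) (measurableSet_multipleZeroSet N s b κ)
  rw [isotropicComplexGaussian, ae_map_iff (by fun_prop) hms, gaussianReal_prod_eq_withDensity hu2]
  refine (withDensity_absolutelyContinuous _ _).ae_le ?_
  have hnull := addHaar_image_eq_zero_of_det_fderivWithin_eq_zero (volume : Measure (ℝ × ℝ))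
    (s := {z | z ∈ Set.Ico 0 (2 * Real.pi) ×ˢ Set.univ ∧ (zeroParamDeriv N s b κ x k₀ z).det = 0})
    (fun z _ => (hasFDerivAt_zeroParam N s b κ x k₀ z).hasFDerivWithinAt) fun z hz => hz.2
  filter_upwards [measure_eq_zero_iff_ae_notMem.1 hnull] with y hy hmem
  obtain ⟨t, ht, h1, h2⟩ := hmem
  refine hy ⟨(t, -y.1 * Real.sin (κ k₀ * t) + y.2 * Real.cos (κ k₀ * t)), ⟨⟨ht, trivial⟩, ?_⟩,
    (zeroParam_eq_iff x hb hk _ _ _ _).2 ⟨h1, rfl⟩⟩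
  rw [trigSumDeriv_update N s b κ x k₀ hk] at h2
  rw [det_zeroParamDeriv, neg_eq_zero, ← mul_right_inj' hb, mul_zero, ← h2]
  field_simp

/-- As the planar Gaussian density is rotation invariant, it factors in the coordinates
`(t, η)`. -/
theorem ofReal_abs_mul_gaussianPDF_zeroParam {v : ℝ≥0} (hb : b k₀ ≠ 0) (z : ℝ × ℝ) :
    ENNReal.ofReal |(zeroParamDeriv N s b κ x k₀ z).det| *
      (gaussianPDF 0 v (zeroParam N s b κ x k₀ z).1 * gaussianPDF 0 v (zeroParam N s b κ x k₀ z).2)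
    = gaussianPDF 0 v z.2 *
      (ENNReal.ofReal |trigSumDeriv N (s.erase k₀) b κ x z.1 + b k₀ * κ k₀ * z.2| *
      gaussianPDF 0 (v * ‖b k₀‖₊ ^ 2) (trigSum N (s.erase k₀) b κ x z.1)) := by
  rw [det_zeroParamDeriv]
  simp only [gaussianPDF, zeroParam]
  set A := trigSum N (s.erase k₀) b κ x z.1
  set A' := trigSumDeriv N (s.erase k₀) b κ x z.1
  have h := Real.sin_sq_add_cos_sq (κ k₀ * z.1)
  set S := Real.sin (κ k₀ * z.1)
  set C := Real.cos (κ k₀ * z.1)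
  rw [← ENNReal.ofReal_mul (gaussianPDFReal_nonneg _ _ _), ← ENNReal.ofReal_mul (abs_nonneg _),
    ← ENNReal.ofReal_mul (abs_nonneg _), ← ENNReal.ofReal_mul (gaussianPDFReal_nonneg _ _ _)]
  congr 1
  have h1 : gaussianPDFReal 0 (v * ‖b k₀‖₊ ^ 2) A = |b k₀|⁻¹ * gaussianPDFReal 0 v (A / b k₀) := by
    rw [div_eq_inv_mul, gaussianPDFReal_inv_mul hb, ← mul_assoc,
      inv_mul_cancel₀ (by simpa using hb),
      one_mul, mul_zero]
    congr 1
    ext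
    simp [mul_comm]
  have h2 : gaussianPDFReal 0 v (-(A / b k₀) * C - z.2 * S) *
      gaussianPDFReal 0 v (-(A / b k₀) * S + z.2 * C) =
      gaussianPDFReal 0 v (A / b k₀) * gaussianPDFReal 0 v z.2 := by
    simp only [gaussianPDFReal]
    rw [mul_mul_mul_comm, mul_mul_mul_comm _ _ _ (Real.exp (-(z.2 - 0) ^ 2 / _)), ← Real.exp_add,
      ← Real.exp_add]
    congr 2
    rw [← add_div, ← add_div]
    congr 1
    linear_combination (-(A / b k₀) ^ 2 - z.2 ^ 2) * h
  have h3 : |-(A' / b k₀ + κ k₀ * z.2)| = |b k₀|⁻¹ * |A' + b k₀ * κ k₀ * z.2| := by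
    rw [abs_neg, ← abs_inv, ← abs_mul]
    congr 1
    field_simp
  rw [h1, h2, h3]
  ring

/-- The conditional Kac–Rice formula: the mean number of zeros when only the `k₀`-th coefficient
is random. -/
theorem lintegral_encard_trigZeros_update {u : ℝ≥0} (hu : u ≠ 0) (hb : b k₀ ≠ 0) (hk : k₀ ∈ s) :
    ∫⁻ z, (((trigZeros N s b κ (Function.update x k₀ z)).encard : ℕ∞) : ENNReal)
        ∂(isotropicComplexGaussian u) =
      ∫⁻ t in Set.Ico 0 (2 * Real.pi), ∫⁻ η,
        ENNReal.ofReal |trigSumDeriv N (s.erase k₀) b κ x t + b k₀ * κ k₀ * η| *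
        gaussianPDF 0 (u / 2 * ‖b k₀‖₊ ^ 2) (trigSum N (s.erase k₀) b κ x t)
        ∂(gaussianReal 0 (u / 2)) := by
  have hu2 : u / 2 ≠ 0 := by positivity
  have hc1 := (continuous_trigSumDeriv N (s.erase k₀) b κ).comp
    (Continuous.prodMk (continuous_const (y := x)) (continuous_fst (X := ℝ) (Y := ℝ)))
  have hc2 := (continuous_trigSum N (s.erase k₀) b κ).comp
    (Continuous.prodMk (continuous_const (y := x)) (continuous_fst (X := ℝ) (Y := ℝ)))
  have hc1' : Measurable fun z : ℝ × ℝ => trigSumDeriv N (s.erase k₀) b κ x z.1 := hc1.measurable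
  have hc2' : Measurable fun z : ℝ × ℝ => trigSum N (s.erase k₀) b κ x z.1 := hc2.measurable
  have hgm : Measurable fun z : ℝ × ℝ =>
      ENNReal.ofReal |trigSumDeriv N (s.erase k₀) b κ x z.1 + b k₀ * κ k₀ * z.2| *
        gaussianPDF 0 (u / 2 * ‖b k₀‖₊ ^ 2) (trigSum N (s.erase k₀) b κ x z.1) := by
    refine Measurable.mul ?_ ((measurable_gaussianPDF _ _).comp hc2')
    fun_prop
  have hgm' : Measurable fun z : ℝ × ℝ => gaussianPDF 0 (u / 2) z.2 *
      (ENNReal.ofReal |trigSumDeriv N (s.erase k₀) b κ x z.1 + b k₀ * κ k₀ * z.2| *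
        gaussianPDF 0 (u / 2 * ‖b k₀‖₊ ^ 2) (trigSum N (s.erase k₀) b κ x z.1)) :=
    Measurable.mul (by fun_prop) hgm
  have hcm : Measurable fun z =>
      (((trigZeros N s b κ (Function.update x k₀ z)).encard : ℕ∞) : ENNReal) :=
    (measurable_encard_trigZeros N s b κ).comp (measurable_update x)
  have hcm' : Measurable fun y : ℝ × ℝ => (((trigZeros N s b κ
      (Function.update x k₀ (y.1 + y.2 * Complex.I))).encard : ℕ∞) : ENNReal) :=
    hcm.comp (g := fun z => (((trigZeros N s b κ (Function.update x k₀ z)).encard : ℕ∞) : ENNReal))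
      (by fun_prop)
  rw [isotropicComplexGaussian, lintegral_map hcm (by fun_prop),
    gaussianReal_prod_eq_withDensity hu2, lintegral_withDensity_eq_lintegral_mul _ (by fun_prop)
      hcm']
  have harea := lintegral_encard_fiber_mul (volume : Measure (ℝ × ℝ))
    (f := zeroParam N s b κ x k₀) (f' := zeroParamDeriv N s b κ x k₀)
    (s := Set.Ico 0 (2 * Real.pi) ×ˢ Set.univ) (measurableSet_Ico.prod MeasurableSet.univ)
    (fun z _ => (hasFDerivAt_zeroParam N s b κ x k₀ z).hasFDerivWithinAt)
    (measurable_det_zeroParamDeriv N s b κ x k₀)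
    (g := fun y => gaussianPDF 0 (u / 2) y.1 * gaussianPDF 0 (u / 2) y.2) (by fun_prop)
  simp_rw [encard_fiber_zeroParam x hb hk, ofReal_abs_mul_gaussianPDF_zeroParam x hb] at harea
  simp only [Pi.mul_apply]
  simp_rw [mul_comm (gaussianPDF _ _ _ * gaussianPDF _ _ _)]
  rw [harea, Measure.volume_eq_prod, ← Measure.prod_restrict, Measure.restrict_univ,
    lintegral_prod _ hgm'.aemeasurable]
  refine lintegral_congr fun t => ?_
  rw [gaussianReal_of_var_ne_zero _ hu2, lintegral_withDensity_eq_lintegral_mul _ (by fun_prop)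
    (by fun_prop)]
  rfl

end KacRice

section KacRiceFormula

variable {Ω : Type*} [MeasurableSpace Ω] {P : Measure Ω} [IsProbabilityMeasure P]
  {u : ℝ≥0} {ξ : ℕ → Ω → ℂ} {N : ℝ} {s : Finset ℕ} {b κ : ℕ → ℝ} {k₀ : ℕ}

theorem ae_notMem_multipleZeroSet (hm : ∀ k, Measurable (ξ k)) (hindep : iIndepFun ξ P)
    (hlaw : ∀ k, P.map (ξ k) = isotropicComplexGaussian u) (hu : u ≠ 0) (hb : b k₀ ≠ 0)
    (hk : k₀ ∈ s) : ∀ᵐ ω ∂P, (fun k => ξ k ω) ∉ multipleZeroSet N s b κ := by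
  have hms := measurableSet_multipleZeroSet N s b κ
  have h1 := lintegral_eq_lintegral_update hm hindep k₀
    (f := (multipleZeroSet N s b κ).indicator fun _ => 1) (measurable_const.indicator hms)
  have h2 : ∀ ω, ∫⁻ z, (multipleZeroSet N s b κ).indicator (fun _ => (1 : ENNReal))
      (Function.update (fun k => ξ k ω) k₀ z) ∂(P.map (ξ k₀)) = 0 := by
    intro ω
    have hi : Measurable fun z => (multipleZeroSet N s b κ).indicator (fun _ => (1 : ENNReal))
        (Function.update (fun k => ξ k ω) k₀ z) :=
      (measurable_const.indicator hms).comp (measurable_update _)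
    rw [hlaw, lintegral_eq_zero_iff hi]
    filter_upwards [ae_update_notMem_multipleZeroSet (N := N) (κ := κ) (fun k => ξ k ω) hu hb hk]
      with z hz
    exact Set.indicator_of_notMem hz _
  simp_rw [h2, lintegral_zero] at h1
  have hi : Measurable fun ω => (multipleZeroSet N s b κ).indicator (fun _ => (1 : ENNReal))
      (fun k => ξ k ω) := (measurable_const.indicator hms).comp (measurable_pi_lambda _ hm)
  rw [lintegral_eq_zero_iff hi] at h1
  filter_upwards [h1] with ω hω hmem
  simp [Set.indicator_of_mem hmem] at hω

theorem lintegral_abs_gaussian_add (V : ℝ≥0) (v : ℝ≥0) (a c : ℝ) :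
    ∫⁻ τ, ∫⁻ η, ENNReal.ofReal |a + τ + c * η| ∂(gaussianReal 0 v) ∂(gaussianReal 0 V) =
      ∫⁻ y, ENNReal.ofReal |a + y| ∂(gaussianReal 0 (V + v * ‖c‖₊ ^ 2)) := by
  have h1 : gaussianReal 0 (V + v * ‖c‖₊ ^ 2) =
      Measure.conv (gaussianReal 0 V) ((gaussianReal 0 v).map (c * ·)) := by
    rw [gaussianReal_map_const_mul, gaussianReal_conv_gaussianReal]
    congr 1
    · simp
    · congr 1
      ext
      simp [mul_comm]
  rw [h1, Measure.lintegral_conv (by fun_prop)]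
  refine lintegral_congr fun τ => ?_
  rw [lintegral_map (by fun_prop) (by fun_prop)]
  simp only [add_assoc]

/-- The average over the other coefficients of the integrand of the conditional formula, for fixed
`t`. The variable `η` takes the place of the rotated imaginary part of the `k₀`-th coefficient. -/
theorem lintegral_abs_trigSumDeriv_mul_gaussianPDF (hm : ∀ k, Measurable (ξ k))
    (hindep : iIndepFun ξ P) (hlaw : ∀ k, P.map (ξ k) = isotropicComplexGaussian u) (hu : u ≠ 0)
    (hb : b k₀ ≠ 0) (hk : k₀ ∈ s) (t : ℝ) :
    ∫⁻ ω, ∫⁻ η, ENNReal.ofReal |trigSumDeriv N (s.erase k₀) b κ (fun k => ξ k ω) t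
        + b k₀ * κ k₀ * η| * gaussianPDF 0 (u / 2 * ‖b k₀‖₊ ^ 2)
          (trigSum N (s.erase k₀) b κ (fun k => ξ k ω) t) ∂(gaussianReal 0 (u / 2)) ∂P =
      gaussianPDF 0 (u / 2 * ∑ k ∈ s, ‖b k‖₊ ^ 2) (Real.cos (N * t)) *
        ∫⁻ y, ENNReal.ofReal |-N * Real.sin (N * t) + y|
          ∂(gaussianReal 0 (u / 2 * ∑ k ∈ s, ‖b k * κ k‖₊ ^ 2)) := by
  have hw : u / 2 * ‖b k₀‖₊ ^ 2 ≠ 0 := by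
    have : ‖b k₀‖₊ ≠ 0 := by simpa using hb
    positivity
  have hF1 : Measurable fun τ : ℝ => ∫⁻ η, ENNReal.ofReal |-N * Real.sin (N * t) + τ
      + b k₀ * κ k₀ * η| ∂(gaussianReal 0 (u / 2)) :=
    Measurable.lintegral_prod_right' (f := fun q : ℝ × ℝ => ENNReal.ofReal
      |-N * Real.sin (N * t) + q.1 + b k₀ * κ k₀ * q.2|) (by fun_prop)
  have hF2 : Measurable fun s : ℝ =>
      gaussianPDF 0 (u / 2 * ‖b k₀‖₊ ^ 2) (Real.cos (N * t) + s) := by fun_prop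
  let F : ℝ × ℝ → ENNReal := fun p =>
    gaussianPDF 0 (u / 2 * ‖b k₀‖₊ ^ 2) (Real.cos (N * t) + p.1) *
      ∫⁻ η, ENNReal.ofReal |-N * Real.sin (N * t) + p.2 + b k₀ * κ k₀ * η|
        ∂(gaussianReal 0 (u / 2))
  have hFm : Measurable F := (hF2.comp measurable_fst).mul (hF1.comp measurable_snd)
  have hmap := map_rotated_sums_eq_prod hm hindep hlaw (s.erase k₀) b (fun k => b k * κ k)
    (fun k => κ k * t)
  have h1 : ∀ ω, ∫⁻ η, ENNReal.ofReal |trigSumDeriv N (s.erase k₀) b κ (fun k => ξ k ω) t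
        + b k₀ * κ k₀ * η| * gaussianPDF 0 (u / 2 * ‖b k₀‖₊ ^ 2)
          (trigSum N (s.erase k₀) b κ (fun k => ξ k ω) t) ∂(gaussianReal 0 (u / 2)) =
      F (∑ k ∈ s.erase k₀, b k * ((ξ k ω).re * Real.cos (κ k * t) + (ξ k ω).im * Real.sin (κ k * t)),
        ∑ k ∈ s.erase k₀, b k * κ k *
          (-(ξ k ω).re * Real.sin (κ k * t) + (ξ k ω).im * Real.cos (κ k * t))) := by
    intro ω
    rw [lintegral_mul_const _ (by fun_prop), mul_comm]
    rfl
  rw [lintegral_congr h1, ← lintegral_map (f := F) hFm (by fun_prop), hmap]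
  rw [lintegral_prod_mul hF2.aemeasurable hF1.aemeasurable, lintegral_gaussianPDF_add _ _ hw,
    lintegral_abs_gaussian_add, ← mul_add, ← mul_add,
    Finset.sum_erase_add s (fun k => ‖b k‖₊ ^ 2) hk,
    Finset.sum_erase_add s (fun k => ‖b k * κ k‖₊ ^ 2) hk]

/-- The Kac–Rice formula for the mean number of zeros in a period: the density at `0` of the value
of the random sum, times the first absolute moment of its derivative, which is independent of the
value. -/
theorem lintegral_encard_trigZeros (hm : ∀ k, Measurable (ξ k)) (hindep : iIndepFun ξ P)
    (hlaw : ∀ k, P.map (ξ k) = isotropicComplexGaussian u) (hu : u ≠ 0) (hb : b k₀ ≠ 0)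
    (hk : k₀ ∈ s) :
    ∫⁻ ω, (((trigZeros N s b κ (fun k => ξ k ω)).encard : ℕ∞) : ENNReal) ∂P =
      ∫⁻ t in Set.Ico 0 (2 * Real.pi),
        gaussianPDF 0 (u / 2 * ∑ k ∈ s, ‖b k‖₊ ^ 2) (Real.cos (N * t)) *
        ∫⁻ y, ENNReal.ofReal |-N * Real.sin (N * t) + y|
          ∂(gaussianReal 0 (u / 2 * ∑ k ∈ s, ‖b k * κ k‖₊ ^ 2)) := by
  let H : Ω → ℝ → ENNReal := fun ω t => ∫⁻ η,
    ENNReal.ofReal |trigSumDeriv N (s.erase k₀) b κ (fun k => ξ k ω) t + b k₀ * κ k₀ * η| *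
      gaussianPDF 0 (u / 2 * ‖b k₀‖₊ ^ 2) (trigSum N (s.erase k₀) b κ (fun k => ξ k ω) t)
    ∂(gaussianReal 0 (u / 2))
  have hA : Measurable fun p : Ω × ℝ => trigSum N (s.erase k₀) b κ (fun k => ξ k p.1) p.2 := by
    unfold trigSum; fun_prop
  have hA' : Measurable fun p : Ω × ℝ => trigSumDeriv N (s.erase k₀) b κ (fun k => ξ k p.1) p.2 := by
    unfold trigSumDeriv; fun_prop
  have hH : Measurable (Function.uncurry H) := by
    have hq : Measurable fun q : (Ω × ℝ) × ℝ =>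
        ENNReal.ofReal |trigSumDeriv N (s.erase k₀) b κ (fun k => ξ k q.1.1) q.1.2
          + b k₀ * κ k₀ * q.2| * gaussianPDF 0 (u / 2 * ‖b k₀‖₊ ^ 2)
            (trigSum N (s.erase k₀) b κ (fun k => ξ k q.1.1) q.1.2) := by
      have h1 : Measurable fun q : (Ω × ℝ) × ℝ =>
          trigSum N (s.erase k₀) b κ (fun k => ξ k q.1.1) q.1.2 := hA.comp measurable_fst
      have h2 : Measurable fun q : (Ω × ℝ) × ℝ =>
          trigSumDeriv N (s.erase k₀) b κ (fun k => ξ k q.1.1) q.1.2 := hA'.comp measurable_fst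
      have h3 := h2.add (measurable_snd.const_mul (b k₀ * κ k₀))
      have h4 : Measurable fun y : ℝ => ENNReal.ofReal |y| := by fun_prop
      exact (h4.comp h3).mul ((measurable_gaussianPDF _ _).comp h1)
    exact hq.lintegral_prod_right' (ν := gaussianReal 0 (u / 2))
  have h1 : ∀ ω, ∫⁻ z, (((trigZeros N s b κ (Function.update (fun k => ξ k ω) k₀ z)).encard : ℕ∞) :
      ENNReal) ∂(P.map (ξ k₀)) = ∫⁻ t in Set.Ico 0 (2 * Real.pi), H ω t := by
    intro ω
    rw [hlaw]
    exact lintegral_encard_trigZeros_update _ hu hb hk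
  rw [lintegral_eq_lintegral_update hm hindep k₀ (measurable_encard_trigZeros N s b κ),
    lintegral_congr h1, lintegral_lintegral_swap hH.aemeasurable]
  exact lintegral_congr fun t =>
    lintegral_abs_trigSumDeriv_mul_gaussianPDF hm hindep hlaw hu hb hk t

end KacRiceFormula

/-! ### Asymptotics of the mean number of zeros -/

/-- The first absolute moment `E|a + ρ Y|` of a Gaussian variable, where `Y` is standard. -/
noncomputable def absMoment (a ρ : ℝ) : ℝ := ∫ y, |a + ρ * y| ∂(gaussianReal 0 1)

theorem integrable_id_gaussianReal : Integrable (fun y : ℝ => y) (gaussianReal 0 1) :=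
  (memLp_id_gaussianReal 1).integrable le_rfl

theorem integrable_abs_add_mul (a ρ : ℝ) :
    Integrable (fun y : ℝ => |a + ρ * y|) (gaussianReal 0 1) :=
  ((integrable_const a).add (integrable_id_gaussianReal.const_mul ρ)).abs

theorem absMoment_nonneg (a ρ : ℝ) : 0 ≤ absMoment a ρ := integral_nonneg fun _ => abs_nonneg _

theorem abs_absMoment_sub_le (a a' ρ ρ' : ℝ) :
    |absMoment a ρ - absMoment a' ρ'| ≤ |a - a'| + |ρ - ρ'| * absMoment 0 1 := by
  have h1 : |a - a'| + |ρ - ρ'| * absMoment 0 1 =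
      ∫ y, (|a - a'| + |ρ - ρ'| * |0 + 1 * y|) ∂(gaussianReal 0 1) := by
    rw [integral_add (integrable_const _) ((integrable_abs_add_mul 0 1).const_mul _),
      integral_const_mul]
    simp [absMoment]
  rw [absMoment, absMoment, ← integral_sub (integrable_abs_add_mul a ρ)
    (integrable_abs_add_mul a' ρ'), h1]
  refine (abs_integral_le_integral_abs).trans (integral_mono ?_ ?_ fun y => ?_)
  · exact ((integrable_abs_add_mul a ρ).sub (integrable_abs_add_mul a' ρ')).abs
  · exact (integrable_const _).add ((integrable_abs_add_mul 0 1).const_mul _)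
  · simp only [zero_add, one_mul]
    refine (abs_abs_sub_abs_le _ _).trans ?_
    rw [← abs_mul, show a + ρ * y - (a' + ρ' * y) = (a - a') + (ρ - ρ') * y by ring]
    exact abs_add_le _ _

theorem absMoment_zero {ρ : ℝ} (hρ : 0 ≤ ρ) : absMoment 0 ρ = ρ * absMoment 0 1 := by
  rw [absMoment, absMoment, ← integral_const_mul]
  refine integral_congr_ae (ae_of_all _ fun y => ?_)
  simp [abs_mul, abs_of_nonneg hρ]

theorem continuous_absMoment (ρ : ℝ) : Continuous fun a => absMoment a ρ := by
  refine (LipschitzWith.of_dist_le_mul (K := 1) fun a a' => ?_).continuous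
  simpa [Real.dist_eq] using abs_absMoment_sub_le a a' ρ ρ

theorem lintegral_ofReal_abs_gaussianReal (a : ℝ) (W : ℝ≥0) :
    ∫⁻ y, ENNReal.ofReal |a + y| ∂(gaussianReal 0 W) = ENNReal.ofReal (absMoment a (√W)) := by
  have h1 : gaussianReal 0 W = (gaussianReal 0 1).map (√W * ·) := by
    rw [gaussianReal_map_const_mul]
    congr 1
    · simp
    · ext
      simp
  rw [h1, lintegral_map (by fun_prop) (by fun_prop), absMoment,
    ofReal_integral_eq_lintegral_ofReal (integrable_abs_add_mul _ _)
      (ae_of_all _ fun _ => abs_nonneg _)]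

theorem absMoment_mul {c : ℝ} (hc : 0 ≤ c) (a ρ : ℝ) :
    absMoment (c * a) (c * ρ) = c * absMoment a ρ := by
  rw [absMoment, absMoment, ← integral_const_mul]
  refine integral_congr_ae (ae_of_all _ fun y => ?_)
  simp only
  rw [mul_assoc, ← mul_add, abs_mul, abs_of_nonneg hc]

/-- The Kac–Rice integral for the mean number of zeros, divided by `2 N`. Here `V` is the
variance of the random part and `ρ` is the ratio of the standard deviation of its derivative to
`N √V`. -/
noncomputable def zeroDensity (V ρ N : ℝ) : ℝ :=
  1 / 2 * ∫ t in Set.Ico 0 (2 * Real.pi),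
    (√(2 * Real.pi))⁻¹ * Real.exp (-Real.cos (N * t) ^ 2 / (2 * V)) *
      absMoment (-Real.sin (N * t) / √V) ρ

section ZeroDensity

variable {V ρ ρ' N : ℝ}

theorem inv_sqrt_two_pi_mul_exp_le_one (hV : 0 < V) (c : ℝ) :
    (√(2 * Real.pi))⁻¹ * Real.exp (-c ^ 2 / (2 * V)) ≤ 1 := by
  have h1 : (√(2 * Real.pi))⁻¹ ≤ 1 := by
    refine inv_le_one_of_one_le₀ (Real.one_le_sqrt.2 ?_)
    linarith [Real.pi_gt_three]
  have h2 : Real.exp (-c ^ 2 / (2 * V)) ≤ 1 := by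
    rw [Real.exp_le_one_iff, neg_div]
    exact neg_nonpos.2 (by positivity)
  exact mul_le_one₀ h1 (Real.exp_nonneg _) h2

theorem integrableOn_zeroDensity (V ρ N : ℝ) :
    IntegrableOn (fun t => (√(2 * Real.pi))⁻¹ * Real.exp (-Real.cos (N * t) ^ 2 / (2 * V)) *
      absMoment (-Real.sin (N * t) / √V) ρ) (Set.Ico 0 (2 * Real.pi)) := by
  refine (Continuous.integrableOn_Icc ?_).mono_set Set.Ico_subset_Icc_self
  have := continuous_absMoment ρ
  fun_prop

theorem abs_half_setIntegral_sub_le {f g : ℝ → ℝ} {C : ℝ}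
    (hf : IntegrableOn f (Set.Ico 0 (2 * Real.pi))) (hg : IntegrableOn g (Set.Ico 0 (2 * Real.pi)))
    (h : ∀ t, |f t - g t| ≤ C) :
    |1 / 2 * (∫ t in Set.Ico 0 (2 * Real.pi), f t) - 1 / 2 * ∫ t in Set.Ico 0 (2 * Real.pi), g t| ≤
      Real.pi * C := by
  rw [← mul_sub, ← integral_sub hf hg, abs_mul]
  have h1 := norm_setIntegral_le_of_norm_le_const (μ := volume) (s := Set.Ico 0 (2 * Real.pi))
    (f := fun t => f t - g t) (C := C) (by rw [Real.volume_Ico]; exact ENNReal.ofReal_lt_top)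
    fun t _ => h t
  rw [Real.norm_eq_abs, measureReal_def, Real.volume_Ico, ENNReal.toReal_ofReal
    (by linarith [Real.pi_pos])] at h1
  rw [abs_of_pos (by norm_num : (0 : ℝ) < 1 / 2)]
  linarith

theorem abs_zeroDensity_sub_le (hV : 0 < V) :
    |zeroDensity V ρ N - zeroDensity V ρ' N| ≤ Real.pi * (|ρ - ρ'| * absMoment 0 1) := by
  refine abs_half_setIntegral_sub_le (integrableOn_zeroDensity V ρ N)
    (integrableOn_zeroDensity V ρ' N) fun t => ?_
  rw [← mul_sub, abs_mul, abs_of_nonneg (by positivity)]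
  refine (mul_le_of_le_one_left (abs_nonneg _) (inv_sqrt_two_pi_mul_exp_le_one hV _)).trans ?_
  simpa using abs_absMoment_sub_le (-Real.sin (N * t) / √V) (-Real.sin (N * t) / √V) ρ ρ'

/-- For large `V` the contribution of the mean to the derivative is negligible, and `zeroDensity`
is almost linear in `ρ`. -/
theorem exists_abs_zeroDensity_sub_mul_le (hV : 0 < V) (N : ℝ) :
    ∃ q : ℝ, ∀ ρ, 0 ≤ ρ → |zeroDensity V ρ N - ρ * q| ≤ Real.pi * (1 / √V) := by
  refine ⟨1 / 2 * ∫ t in Set.Ico 0 (2 * Real.pi),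
    (√(2 * Real.pi))⁻¹ * Real.exp (-Real.cos (N * t) ^ 2 / (2 * V)) * absMoment 0 1,
    fun ρ hρ => ?_⟩
  rw [mul_left_comm, ← integral_const_mul]
  refine abs_half_setIntegral_sub_le (integrableOn_zeroDensity V ρ N) ?_ fun t => ?_
  · refine (Continuous.integrableOn_Icc ?_).mono_set Set.Ico_subset_Icc_self
    fun_prop
  · rw [mul_left_comm, ← absMoment_zero hρ, ← mul_sub, abs_mul, abs_of_nonneg (by positivity)]
    refine (mul_le_of_le_one_left (abs_nonneg _) (inv_sqrt_two_pi_mul_exp_le_one hV _)).trans ?_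
    refine (abs_absMoment_sub_le _ _ _ _).trans ?_
    rw [sub_self, abs_zero, zero_mul, add_zero, sub_zero, abs_div, abs_neg,
      abs_of_nonneg (Real.sqrt_nonneg V)]
    gcongr
    exact Real.abs_sin_le_one _

theorem abs_zeroDensity_sub_self_le (hV : 0 < V) (hρ : 0 ≤ ρ) (h1 : zeroDensity V 1 N = 1) :
    |zeroDensity V ρ N - ρ| ≤ (1 + ρ) * (Real.pi * (1 / √V)) := by
  obtain ⟨q, hq⟩ := exists_abs_zeroDensity_sub_mul_le hV N
  have h2 := hq ρ hρ
  have h3 := hq 1 zero_le_one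
  rw [h1, one_mul] at h3
  calc |zeroDensity V ρ N - ρ| = |(zeroDensity V ρ N - ρ * q) + ρ * (-(1 - q))| := by
        congr 1; ring
    _ ≤ |zeroDensity V ρ N - ρ * q| + ρ * |1 - q| := by
        refine (abs_add_le _ _).trans ?_
        rw [abs_mul, abs_neg, abs_of_nonneg hρ]
    _ ≤ Real.pi * (1 / √V) + ρ * (Real.pi * (1 / √V)) := by gcongr
    _ = _ := by ring

theorem lintegral_gaussianPDF_mul_eq {V W : ℝ≥0} (hV : V ≠ 0) (hN : 0 < N) :
    ∫⁻ t in Set.Ico 0 (2 * Real.pi), gaussianPDF 0 V (Real.cos (N * t)) *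
        ∫⁻ y, ENNReal.ofReal |-N * Real.sin (N * t) + y| ∂(gaussianReal 0 W) =
      ENNReal.ofReal (2 * N * zeroDensity V (√W / (N * √V)) N) := by
  have hV' : (0 : ℝ) < V := by exact_mod_cast pos_iff_ne_zero.2 hV
  have hs : 0 < √(V : ℝ) := Real.sqrt_pos.2 hV'
  rw [zeroDensity, ← mul_assoc, ← integral_const_mul, ofReal_integral_eq_lintegral_ofReal
    ((integrableOn_zeroDensity _ _ _).const_mul _)]
  · refine lintegral_congr fun t => ?_
    rw [lintegral_ofReal_abs_gaussianReal, gaussianPDF,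
      ← ENNReal.ofReal_mul (gaussianPDFReal_nonneg _ _ _)]
    congr 1
    have h1 : absMoment (-N * Real.sin (N * t)) (√W) =
        N * √V * absMoment (-Real.sin (N * t) / √V) (√W / (N * √V)) := by
      rw [← absMoment_mul (by positivity)]
      congr 1 <;> field_simp
    rw [h1, gaussianPDFReal, Real.sqrt_mul (by positivity), sub_zero]
    field_simp
  · refine ae_of_all _ fun t => ?_
    have := absMoment_nonneg (-Real.sin (N * t) / √V) (√W / (N * √V))
    simp only [Pi.zero_apply]
    positivity

end ZeroDensity

theorem encard_int_Ico (a : ℝ) (n : ℕ) :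
    {j : ℤ | a ≤ j ∧ (j : ℝ) < a + n}.encard = n := by
  have h : {j : ℤ | a ≤ j ∧ (j : ℝ) < a + n} = (Finset.Ico ⌈a⌉ (⌈a⌉ + n) : Finset ℤ) := by
    ext j
    simp only [Set.mem_ofPred_eq, Finset.coe_Ico, Set.mem_Ico, Int.ceil_le]
    refine and_congr_right fun _ => ?_
    have : j < ⌈a⌉ + n ↔ ¬ (⌈a⌉ ≤ j - n) := by omega
    rw [this, Int.ceil_le, not_le]
    push_cast
    rw [sub_lt_iff_lt_add]
  rw [h, Set.encard_coe_eq_coe_finsetCard]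
  simp

/-- A nonzero combination of `cos (N t)` and `sin (N t)`, `N = m + 1 / 2`, has exactly `2 m + 1`
zeros in a period. -/
theorem encard_zeros_single_frequency (m : ℕ) {p q : ℝ} (hpq : p ≠ 0 ∨ q ≠ 0) :
    {t | t ∈ Set.Ico 0 (2 * Real.pi) ∧
      p * Real.cos ((m + 1 / 2) * t) + q * Real.sin ((m + 1 / 2) * t) = 0}.encard =
        (2 * m + 1 : ℕ) := by
  set N : ℝ := m + 1 / 2 with hN
  have hN0 : 0 < N := by positivity
  have hpi := Real.pi_pos
  set w : ℂ := ⟨p, q⟩ with hw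
  have hw0 : w ≠ 0 := by
    intro h
    rcases hpq with h1 | h1
    · exact h1 (congrArg Complex.re h)
    · exact h1 (congrArg Complex.im h)
  set θ := w.arg
  have hp : p = ‖w‖ * Real.cos θ := (Complex.norm_mul_cos_arg w).symm
  have hq : q = ‖w‖ * Real.sin θ := (Complex.norm_mul_sin_arg w).symm
  have hzero : ∀ t, p * Real.cos (N * t) + q * Real.sin (N * t) = 0 ↔
      ∃ j : ℤ, N * t - θ = (2 * j + 1) * Real.pi / 2 := by
    intro t
    have h1 : p * Real.cos (N * t) + q * Real.sin (N * t) = ‖w‖ * Real.cos (N * t - θ) := by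
      rw [Real.cos_sub, hp, hq]; ring
    rw [h1, mul_eq_zero, or_iff_right (norm_ne_zero_iff.2 hw0), Real.cos_eq_zero_iff]
  rw [← encard_int_Ico (-(θ / Real.pi + 1 / 2)) (2 * m + 1)]
  have hinj : Function.Injective fun j : ℤ => (θ + (2 * j + 1) * Real.pi / 2) / N := by
    intro i j hij
    have h1 := (div_left_inj' hN0.ne').1 hij
    have h2 : (i : ℝ) * Real.pi = j * Real.pi := by linarith
    exact_mod_cast mul_right_cancel₀ hpi.ne' h2
  rw [← hinj.injOn.encard_image]
  congr 1
  have hrange : ∀ j : ℤ, (θ + (2 * j + 1) * Real.pi / 2) / N ∈ Set.Ico 0 (2 * Real.pi) ↔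
      -(θ / Real.pi + 1 / 2) ≤ j ∧ (j : ℝ) < -(θ / Real.pi + 1 / 2) + (2 * m + 1 : ℕ) := by
    intro j
    have e : (θ + (2 * j + 1) * Real.pi / 2) = Real.pi * (j + (θ / Real.pi + 1 / 2)) := by
      field_simp
      ring
    rw [e, Set.mem_Ico, le_div_iff₀ hN0, div_lt_iff₀ hN0, zero_mul,
      mul_nonneg_iff_of_pos_left hpi, show 2 * Real.pi * N = Real.pi * (2 * m + 1 : ℕ) by
        rw [hN]; push_cast; ring, mul_lt_mul_iff_right₀ hpi]
    constructor <;> rintro ⟨h1, h2⟩ <;> constructor <;> linarith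
  refine Set.ext fun t => ?_
  constructor
  · rintro ⟨ht, h0⟩
    obtain ⟨j, hj⟩ := (hzero t).1 h0
    have htj : (θ + (2 * j + 1) * Real.pi / 2) / N = t := by
      rw [← hj]; field_simp; ring
    refine ⟨j, (hrange j).1 (htj ▸ ht), htj⟩
  · rintro ⟨j, hj, rfl⟩
    refine ⟨(hrange j).2 hj, (hzero _).2 ⟨j, ?_⟩⟩
    field_simp
    ring

section Expectation

variable {Ω : Type*} [MeasurableSpace Ω] {P : Measure Ω} [IsProbabilityMeasure P]
  {u : ℝ≥0} {ξ : ℕ → Ω → ℂ}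

/-- The case `ρ = 1` of the Kac–Rice integral is evaluated by counting: it is the mean number of
zeros of a random combination of `cos (N t)` and `sin (N t)`. -/
theorem zeroDensity_one (hm : ∀ k, Measurable (ξ k)) (hindep : iIndepFun ξ P)
    (hlaw : ∀ k, P.map (ξ k) = isotropicComplexGaussian u) (hu : u ≠ 0) {V : ℝ} (hV : 0 < V)
    (m : ℕ) : zeroDensity V 1 (m + 1 / 2) = 1 := by
  set N : ℝ := m + 1 / 2 with hN
  have hN0 : 0 < N := by positivity
  have hu' : (0 : ℝ) < u := by exact_mod_cast pos_iff_ne_zero.2 hu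
  -- With this factor the random part has variance `V`, and its derivative `N ^ 2 * V`.
  set c : ℝ := √(V / (u / 2)) with hc
  have hc0 : 0 < c := Real.sqrt_pos.2 (by positivity)
  have h1 := lintegral_encard_trigZeros (N := N) (s := {0}) (b := fun _ => c) (κ := fun _ => N)
    hm hindep hlaw hu hc0.ne' (Finset.mem_singleton_self 0)
  have h2 : ∀ᵐ ω ∂P, (((trigZeros N {0} (fun _ => c) (fun _ => N) (fun k => ξ k ω)).encard : ℕ∞) :
      ENNReal) = (2 * m + 1 : ℕ) := by
    filter_upwards [ae_notMem_multipleZeroSet (N := N) (s := {0}) (b := fun _ => c)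
      (κ := fun _ => N) hm hindep hlaw hu hc0.ne' (Finset.mem_singleton_self 0)] with ω hω
    have hF : ∀ t, trigSum N {0} (fun _ => c) (fun _ => N) (fun k => ξ k ω) t =
        (1 + c * (ξ 0 ω).re) * Real.cos (N * t) + c * (ξ 0 ω).im * Real.sin (N * t) := by
      intro t
      simp only [trigSum, Finset.sum_singleton]
      ring
    have hne : 1 + c * (ξ 0 ω).re ≠ 0 ∨ c * (ξ 0 ω).im ≠ 0 := by
      -- Otherwise the sum vanishes identically, and `0` is a multiple zero.
      by_contra hcon
      simp only [not_or, not_not] at hcon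
      refine hω ⟨0, ⟨le_rfl, by positivity⟩, ?_, ?_⟩
      · rw [hF, hcon.1, hcon.2]; ring
      · simp only [trigSumDeriv, Finset.sum_singleton, mul_zero, Real.sin_zero, Real.cos_zero]
        linear_combination N * hcon.2
    have := encard_zeros_single_frequency m hne
    rw [trigZeros]
    simp_rw [hF]
    rw [this]
    simp
  rw [lintegral_congr_ae h2, lintegral_const, measure_univ, mul_one] at h1
  simp only [Finset.sum_singleton] at h1
  have hV1 : ((u / 2 * ‖c‖₊ ^ 2 : ℝ≥0) : ℝ) = V := by
    push_cast
    rw [Real.norm_eq_abs, sq_abs, hc, Real.sq_sqrt (by positivity)]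
    field_simp
  have hV2 : u / 2 * ‖c‖₊ ^ 2 ≠ 0 := by
    intro h
    rw [h, NNReal.coe_zero] at hV1
    exact hV.ne hV1
  have hW1 : √((u / 2 * ‖c * N‖₊ ^ 2 : ℝ≥0) : ℝ) = N * √V := by
    rw [nnnorm_mul, mul_pow, ← mul_assoc, NNReal.coe_mul, hV1, mul_comm V,
      Real.sqrt_mul (by positivity)]
    congr 1
    push_cast
    rw [Real.sqrt_sq (norm_nonneg _), Real.norm_of_nonneg hN0.le]
  rw [lintegral_gaussianPDF_mul_eq hV2 hN0, hW1, hV1, div_self (by positivity)] at h1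
  have h3 : ENNReal.ofReal (2 * N) = ENNReal.ofReal (2 * N * zeroDensity V 1 N) := by
    rw [← h1, show 2 * N = ((2 * m + 1 : ℕ) : ℝ) by rw [hN]; push_cast; ring,
      ENNReal.ofReal_natCast]
  have h4 : 0 < 2 * N * zeroDensity V 1 N := by
    rw [← ENNReal.ofReal_pos, ← h3, ENNReal.ofReal_pos]
    positivity
  rw [ENNReal.ofReal_eq_ofReal_iff (by positivity) h4.le] at h3
  exact (mul_left_cancel₀ (show 2 * N ≠ 0 by positivity) (by linarith)).symm

/-- The Kac–Rice formula for the self-inversive polynomial. -/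
theorem integral_unitCircleZeroCount (hm : ∀ k, Measurable (ξ k)) (hindep : iIndepFun ξ P)
    (hlaw : ∀ k, P.map (ξ k) = isotropicComplexGaussian u) (hu : u ≠ 0) (b : ℝ → ℝ) (m : ℕ)
    (hb : b m ≠ 0) (hm0 : 1 ≤ m) :
    ∫ ω, (unitCircleZeroCount (selfInversivePoly b (fun k => ξ k ω) m) : ℝ) / (2 * m + 1) ∂P =
      zeroDensity (u / 2 * partialSum (fun k => b k ^ 2) m)
        (√((∑ k ∈ Finset.Icc 1 m, b k ^ 2 * (1 - k / (m + 1 / 2)) ^ 2) /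
          partialSum (fun k => b k ^ 2) m)) (m + 1 / 2) := by
  set N : ℝ := m + 1 / 2 with hN
  have hN0 : 0 < N := by positivity
  have hu' : (0 : ℝ) < u := by exact_mod_cast pos_iff_ne_zero.2 hu
  have hmem : m ∈ Finset.Icc 1 m := Finset.mem_Icc.2 ⟨hm0, le_rfl⟩
  set Z : Ω → ENNReal := fun ω => (((trigZeros N (Finset.Icc 1 m) (fun k => b k) (fun k => N - k)
    (fun k => ξ k ω)).encard : ℕ∞) : ENNReal) with hZ
  have hZm : Measurable Z := (measurable_encard_trigZeros _ _ _ _).comp (measurable_pi_lambda _ hm)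
  have hae : ∀ᵐ ω ∂P, Z ω = unitCircleZeroCount (selfInversivePoly b (fun k => ξ k ω) m) := by
    filter_upwards [ae_notMem_multipleZeroSet (N := N) (κ := fun k => N - k)
      (b := fun k : ℕ => b k) hm hindep hlaw hu hb hmem] with ω hω
    rw [hZ]
    simp only
    rw [← unitCircleZeroCount_eq_encard b _ m hω]
    simp
  have h1 : ∫ ω, (unitCircleZeroCount (selfInversivePoly b (fun k => ξ k ω) m) : ℝ) / (2 * m + 1) ∂P
      = (∫⁻ ω, Z ω ∂P).toReal / (2 * m + 1) := by
    rw [integral_div, ← integral_toReal hZm.aemeasurable]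
    · congr 1
      refine integral_congr_ae ?_
      filter_upwards [hae] with ω hω
      rw [hω]
      simp
    · filter_upwards [hae] with ω hω
      rw [hω]
      exact ENNReal.natCast_lt_top _
  have h2 := lintegral_encard_trigZeros (N := N) (κ := fun k => N - k)
      (b := fun k : ℕ => b k) hm hindep hlaw hu hb hmem
  set V : ℝ≥0 := u / 2 * ∑ k ∈ Finset.Icc 1 m, ‖b k‖₊ ^ 2 with hVdef
  set W : ℝ≥0 := u / 2 * ∑ k ∈ Finset.Icc 1 m, ‖b k * (N - k)‖₊ ^ 2 with hWdef
  have hS : 0 < partialSum (fun k => b k ^ 2) m := by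
    rw [partialSum_eq_sum_Icc]
    exact Finset.sum_pos' (s := Finset.Icc 1 m) (f := fun k : ℕ => b k ^ 2)
      (fun k _ => sq_nonneg _) ⟨m, hmem, by positivity⟩
  have hV : (V : ℝ) = u / 2 * partialSum (fun k => b k ^ 2) m := by
    rw [hVdef, partialSum_eq_sum_Icc]
    push_cast
    simp
  have hW : (W : ℝ) = u / 2 * (N ^ 2 * ∑ k ∈ Finset.Icc 1 m, b k ^ 2 * (1 - k / N) ^ 2) := by
    rw [Finset.mul_sum _ _ (N ^ 2), hWdef]
    push_cast
    congr 1
    refine Finset.sum_congr rfl fun k _ => ?_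
    rw [← mul_pow, Real.norm_eq_abs, sq_abs, ← mul_pow]
    congr 1
    field_simp
  have hV0 : V ≠ 0 := by
    intro h
    rw [h, NNReal.coe_zero] at hV
    have : 0 < u / 2 * partialSum (fun k => b k ^ 2) m := by positivity
    linarith
  have hρ : √(W : ℝ) / (N * √V) = √((∑ k ∈ Finset.Icc 1 m, b k ^ 2 * (1 - k / N) ^ 2) /
      partialSum (fun k => b k ^ 2) m) := by
    rw [hV, hW, ← Real.sqrt_sq hN0.le, ← Real.sqrt_mul (sq_nonneg _),
      ← Real.sqrt_div' _ (by positivity),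
      Real.sqrt_sq hN0.le]
    congr 1
    field_simp
  rw [lintegral_gaussianPDF_mul_eq hV0 hN0, hρ, hV] at h2
  have hpos : 0 ≤ zeroDensity (u / 2 * partialSum (fun k => b k ^ 2) m)
      (√((∑ k ∈ Finset.Icc 1 m, b k ^ 2 * (1 - k / N) ^ 2) /
        partialSum (fun k => b k ^ 2) m)) N := by
    refine mul_nonneg (by norm_num) (integral_nonneg fun t => ?_)
    have := absMoment_nonneg (-Real.sin (N * t) / √(u / 2 * partialSum (fun k => b k ^ 2) m))
      (√((∑ k ∈ Finset.Icc 1 m, b k ^ 2 * (1 - k / N) ^ 2) / partialSum (fun k => b k ^ 2) m))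
    simp only [Pi.zero_apply]
    positivity
  rw [h1, hZ, h2, ENNReal.toReal_ofReal (by positivity),
    show (2 * m + 1 : ℝ) = 2 * N by rw [hN]; ring]
  field_simp

end Expectation

/-- Both regimes at once: with `β = max (2 α + 1) 0` the mean proportion of zeros on the circle
tends to `√(2 / ((β + 1) (β + 2)))`. -/
theorem tendsto_integral_zeroCount {Ω : Type*} [MeasurableSpace Ω] {P : Measure Ω}
    [IsProbabilityMeasure P] {α : ℝ} {ℓ b : ℝ → ℝ} (hℓ : IsSlowlyVarying ℓ)
    (hb : ∀ x : ℝ, 0 < x → b x = x ^ α * ℓ x) {u : ℝ≥0} (hu : u ≠ 0) {ξ : ℕ → Ω → ℂ}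
    (hm : ∀ k, Measurable (ξ k)) (hindep : iIndepFun ξ P)
    (hlaw : ∀ k, P.map (ξ k) = isotropicComplexGaussian u) :
    Tendsto (fun m : ℕ => ∫ ω,
        (unitCircleZeroCount (selfInversivePoly b (fun k => ξ k ω) m) : ℝ) / (2 * m + 1) ∂P)
      atTop (𝓝 (√(2 / ((max (2 * α + 1) 0 + 1) * (max (2 * α + 1) 0 + 2))))) := by
  have ha := hℓ.isRegularlyVaryingSeq_sq hb
  set a : ℕ → ℝ := fun n => b n ^ 2 with hadef
  set ρ : ℕ → ℝ := fun m => √((∑ k ∈ Finset.Icc 1 m, a k * (1 - k / (m + 1 / 2)) ^ 2) /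
    partialSum a m) with hρdef
  set V : ℕ → ℝ := fun m => u / 2 * partialSum a m with hVdef
  have hu' : (0 : ℝ) < u := by exact_mod_cast pos_iff_ne_zero.2 hu
  have hρ : Tendsto ρ atTop (𝓝 (√(2 / ((max (2 * α + 1) 0 + 1) * (max (2 * α + 1) 0 + 2))))) :=
    (Real.continuous_sqrt.tendsto _).comp ha.tendsto_weighted_average
  have hVpos : ∀ᶠ m in atTop, 0 < V m := by
    filter_upwards [ha.eventually_partialSum_pos] with m h
    positivity
  have hJ : (fun m : ℕ => zeroDensity (V m) (ρ m) (m + 1 / 2)) =ᶠ[atTop] fun m : ℕ => ∫ ω,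
      (unitCircleZeroCount (selfInversivePoly b (fun k => ξ k ω) m) : ℝ) / (2 * m + 1) ∂P := by
    filter_upwards [ha.eventually_pos, eventually_ge_atTop 1] with m h1 h2
    have hbm : b m ≠ 0 := fun h => h1.ne' (by simp [hadef, h])
    exact (integral_unitCircleZeroCount hm hindep hlaw hu b m hbm h2).symm
  refine Tendsto.congr' hJ ?_
  suffices h : Tendsto (fun m : ℕ => zeroDensity (V m) (ρ m) (m + 1 / 2) - ρ m) atTop (𝓝 0) by
    simpa using h.add hρ
  rcases le_or_gt (2 * α + 1) 0 with hα | hα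
  · have h1 : Tendsto (fun m => |ρ m - 1|) atTop (𝓝 0) := by
      rw [max_eq_right hα] at hρ
      norm_num at hρ
      simpa using (hρ.sub_const 1).abs
    have h2 : Tendsto (fun m => Real.pi * (|ρ m - 1| * absMoment 0 1) + |ρ m - 1|) atTop (𝓝 0) := by
      simpa using ((h1.mul_const (absMoment 0 1)).const_mul Real.pi).add h1
    refine squeeze_zero_norm' ?_ h2
    filter_upwards [hVpos] with m hVm
    have h3 := abs_zeroDensity_sub_le (ρ := ρ m) (ρ' := 1) (N := m + 1 / 2) hVm
    rw [zeroDensity_one hm hindep hlaw hu hVm] at h3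
    rw [Real.norm_eq_abs, show zeroDensity (V m) (ρ m) (m + 1 / 2) - ρ m =
      (zeroDensity (V m) (ρ m) (m + 1 / 2) - 1) - (ρ m - 1) by ring]
    exact (abs_sub _ _).trans (by gcongr)
  · have hVt : Tendsto V atTop atTop :=
      (ha.partialSum_tendsto_atTop hα).const_mul_atTop (by positivity)
    have h1 : Tendsto (fun m => 1 / √(V m)) atTop (𝓝 0) :=
      tendsto_const_nhds.div_atTop (Real.tendsto_sqrt_atTop.comp hVt)
    have h2 := (hρ.const_add 1).mul (h1.const_mul Real.pi)
    rw [mul_zero, mul_zero] at h2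
    refine squeeze_zero_norm' ?_ h2
    filter_upwards [hVpos] with m hVm
    exact abs_zeroDensity_sub_self_le hVm (Real.sqrt_nonneg _)
      (zeroDensity_one hm hindep hlaw hu hVm m)

theorem theorem4p3 {Ω : Type*} [MeasurableSpace Ω] (P : Measure Ω) [IsProbabilityMeasure P]
    (α : ℝ) (ℓ b : ℝ → ℝ) (hℓ : IsSlowlyVarying ℓ)
    (hb : ∀ x : ℝ, 0 < x → b x = x ^ α * ℓ x)
    (σ : ℝ≥0) (hσ : 0 < σ) (ξ : ℕ → Ω → ℂ) (hindep : iIndepFun ξ P)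
    (hlaw : ∀ k, HasLaw (ξ k) (isotropicComplexGaussian (σ ^ 2)) P) :
    (α ≤ -1 / 2 →
      Tendsto (fun m : ℕ => ∫ ω,
          (unitCircleZeroCount (selfInversivePoly b (fun k => ξ k ω) m) : ℝ) / (2 * m + 1) ∂P)
        atTop (𝓝 1)) ∧
    (-1 / 2 < α →
      Tendsto (fun m : ℕ => ∫ ω,
          (unitCircleZeroCount (selfInversivePoly b (fun k => ξ k ω) m) : ℝ) / (2 * m + 1) ∂P)
        atTop (𝓝 (1 / √((1 + α) * (3 + 2 * α)))) ∧
      1 / √((1 + α) * (3 + 2 * α)) < 1) := by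
  -- Only a.e. measurability is given: pass to measurable modifications.
  have hmk : ∀ k, ξ k =ᵐ[P] (hlaw k).aemeasurable.mk (ξ k) := fun k =>
    (hlaw k).aemeasurable.ae_eq_mk
  have hmain := tendsto_integral_zeroCount (P := P) hℓ hb (pow_pos hσ 2).ne'
    (ξ := fun k => (hlaw k).aemeasurable.mk (ξ k)) (fun k => (hlaw k).aemeasurable.measurable_mk)
    (hindep.congr hmk) fun k => by rw [← Measure.map_congr (hmk k), (hlaw k).map_eq]
  have heq : ∀ m : ℕ, ∫ ω, (unitCircleZeroCount (selfInversivePoly b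
      (fun k => (hlaw k).aemeasurable.mk (ξ k) ω) m) : ℝ) / (2 * m + 1) ∂P = ∫ ω,
      (unitCircleZeroCount (selfInversivePoly b (fun k => ξ k ω) m) : ℝ) / (2 * m + 1) ∂P := by
    intro m
    refine integral_congr_ae ?_
    filter_upwards [ae_all_iff.2 hmk] with ω hω
    simp only [← hω]
  simp_rw [heq] at hmain
  refine ⟨fun hα => ?_, fun hα => ⟨?_, ?_⟩⟩
  · rw [max_eq_right (by linarith)] at hmain
    norm_num at hmain
    exact hmain
  · rw [max_eq_left (by linarith)] at hmain
    rw [one_div, ← Real.sqrt_inv]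
    have h1 : 1 + α ≠ 0 := by linarith
    have h2 : 3 + 2 * α ≠ 0 := by linarith
    have h3 : 2 / ((2 * α + 1 + 1) * (2 * α + 1 + 2)) = ((1 + α) * (3 + 2 * α))⁻¹ := by
      rw [show (2 * α + 1 + 1) * (2 * α + 1 + 2) = 2 * ((1 + α) * (3 + 2 * α)) by ring]
      field_simp
    rw [← h3]
    exact hmain
  · have h1 : 1 < (1 + α) * (3 + 2 * α) := by nlinarith
    have h2 : 1 < √((1 + α) * (3 + 2 * α)) := by
      rw [Real.lt_sqrt zero_le_one, one_pow]
      exact h1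
    rw [div_lt_one (by linarith)]
    exact h2
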